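/- Let $r,\tilde r\ge 0$, $d=r+\tilde r+1$, $k=\tilde r+1$, and let $K$ be a field of characteristic $0$. Consider independent variables $\boldsymbol\xi=(x,y,z,\tilde x,\tilde y,\tilde z)$, namely $x_j,y_j$ ($0\le j\le r-1$), $z_j$ ($0\le j\le r-2$), $\tilde x_j,\tilde y_j$ ($0\le j\le \tilde r-1$), $\tilde z_j$ ($0\le j\le\tilde r-2$), where the $y_j$ are absent if $\tilde r=0$ and the $\tilde y_j$ are absent if $r=0$. A tilde on a formula exchanges $r\leftrightarrow\tilde r$ and tilded with untilded symbols. Absent variables and their exponents, and $z_{r-1}$, are read as $0$, and $u_0=\tilde u_0=1$, $u_{r+1}=\tilde u_{\tilde r+1}=0$ (also $\tilde u_1=0$ if $\tilde r=0$, $u_1=0$ if $r=0$). **Part 1.** The system $$u_i=u_{i-1}-x_{i-1}u_1u_i-y_{i-1}\tilde u_1u_i+z_{i-1}u_{i+1}\quad(1\le i\le r)$$ together with its tilded version $(1\le i\le\tilde r)$ has exactly one solution $(u,\tilde u)$ in $K[[\boldsymbol\xi]]$; its components are invertible, and for all $\mathbf k\in\mathbb Z^r$, $\tilde{\mathbf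 k}\in\mathbb Z^{\tilde r}$ the monomial $u^{\mathbf k}\tilde u^{\tilde{\mathbf k}}=\prod_{i=1}^r u_i^{k_i}\prod_{i=1}^{\tilde r}\tilde u_i^{\tilde k_i}$ is $$u^{\mathbf k}\tilde u^{\tilde{\mathbf k}}=E_{\mathbf k,\tilde{\mathbf k}}(\boldsymbol\xi):=\sum_{i=-1}^{r-1}\sum_{\iota=-1}^{\tilde r-1}\boldsymbol\xi^{\mathfrak f_i+\tilde{\mathfrak f}_\iota}\,\Phi(\boldsymbol\xi;\pi+\nu^i,\tilde\pi+\tilde\nu^\iota)-\sum_{i=0}^{r-1}\sum_{\iota=0}^{\tilde r-1}\boldsymbol\xi^{\mathfrak g_i+\tilde{\mathfrak g}_\iota}\,\Phi(\boldsymbol\xi;\pi+\nu^i,\tilde\pi+\tilde\nu^\iota),$$ where, for $0\le j\le r-1$, $\pi_j=k_{j+1}+\dots+k_r$ and $\nu^i_j=2\sigma_{i,j-1}$, with $\sigma_{ij}=1$ if $i>j$ and $0$ otherwise; $\boldsymbol\xi^{\mathfrak f_i}=\prod_{j=0}^{r-1}x_j^{\delta_{ij}}z_j^{\sigma_{ij}}$,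 $\boldsymbol\xi^{\mathfrak g_i}=\prod_{j=0}^{r-1}y_j^{\delta_{ij}}z_j^{\sigma_{ij}}$ (with $0^0=1$); and for integer vectors $\mu\in\mathbb Z^r$, $\tilde\mu\in\mathbb Z^{\tilde r}$ $$\Phi(\boldsymbol\xi;\mu,\tilde\mu)=\sum_{\mathbf q\ge0}(-1)^{|m|+|n|+|\tilde m|+|\tilde n|}\boldsymbol\xi^{\mathbf q}\prod_{j=0}^{r-1}\binom{\mu_j+m_j+n_j+p_{j-1}+p_j-1}{m_j,\,n_j,\,p_j}\prod_{j=0}^{\tilde r-1}\binom{\tilde\mu_j+\tilde m_j+\tilde n_j+\tilde p_{j-1}+\tilde p_j-1}{\tilde m_j,\,\tilde n_j,\,\tilde p_j},$$ where $\boldsymbol\xi^{\mathbf q}=x^my^nz^p\tilde x^{\tilde m}\tilde y^{\tilde n}\tilde z^{\tilde p}$, $|m|=\sum_j m_j$ etc., $p_{-1}=|m|+|\tilde n|$, $\tilde p_{-1}=|\tilde m|+|n|$, $p_{r-1}=\tilde p_{\tilde r-1}=0$, and $\binom{a}{m,n,p}=\frac{a(a-1)\cdots(a-m-n-p+1)}{m!\,n!\,p!}$.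 **Part 2.** Let $M$ be the $d\times d$ tridiagonal matrix with diagonal $\alpha_1,\dots,\alpha_d\in K$, where $\alpha_j\ne\alpha_k$ for $j\ne k$, superdiagonal $\beta_1,\dots,\beta_{d-1}$ and subdiagonal $\gamma_1,\dots,\gamma_{d-1}$, the $\beta_j,\gamma_j$ being independent variables. Put $a_i=\alpha_{k+i}-\alpha_k$, $\tilde a_i=\alpha_{k-i}-\alpha_k$, $b_i=\beta_{k+i}$, $c_i=\gamma_{k+i}$, $\tilde b_i=\beta_{k-1-i}$, $\tilde c_i=\gamma_{k-1-i}$. There is exactly one pair $(\Lambda,V)$ over $K[[\beta,\gamma]]$ with $MV=\Lambda V$, $V_k=1$, and constant terms $\Lambda(0)=\alpha_k$, $V_j(0)=0$ for $j\ne k$. Write $v_i=V_{k+i}$, $\tilde v_i=V_{k-i}$, $\Lambda=\alpha_k+\lambda$. There are invertible series $u_i,\tilde u_i\in K[[\beta,\gamma]]$ with $$v_i=(-1)^i\frac{c_0\cdots c_{i-1}}{a_1\cdots a_i}\,u_i\ (1\le i\le r),\qquad \tilde v_i=(-1)^i\frac{\tilde b_0\cdots\tilde b_{i-1}}{\tilde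 a_1\cdots\tilde a_i}\,\tilde u_i\ (1\le i\le\tilde r),$$ and for all $\mathbf k\in\mathbb Z^r,\tilde{\mathbf k}\in\mathbb Z^{\tilde r}$ one has $u^{\mathbf k}\tilde u^{\tilde{\mathbf k}}=E_{\mathbf k,\tilde{\mathbf k}}(\boldsymbol\xi)$ after the substitution $$x_i=\frac{b_0c_0}{a_1a_{i+1}},\quad y_i=\frac{\tilde b_0\tilde c_0}{\tilde a_1a_{i+1}},\quad z_i=\frac{b_{i+1}c_{i+1}}{a_{i+1}a_{i+2}},\quad \tilde x_i=\frac{\tilde b_0\tilde c_0}{\tilde a_1\tilde a_{i+1}},\quad \tilde y_i=\frac{b_0c_0}{a_1\tilde a_{i+1}},\quad \tilde z_i=\frac{\tilde b_{i+1}\tilde c_{i+1}}{\tilde a_{i+1}\tilde a_{i+2}}.$$ In particular, taking for $(\mathbf k,\tilde{\mathbf k})$ the unit vectors gives explicit series for all $v_i$ and $\tilde v_i$, and inserting those for $v_1$ and $\tilde v_1$ in $\lambda=\tilde c_0\tilde v_1+b_0v_1$ gives one for the eigenvalue (a term whose side is empty, $r=0$ or $\tilde r=0$, is absent). -/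

import Mathlib

namespace JacobiSpectral

open MvPowerSeries

/-- The two sides of the distinguished diagonal entry: `plain` is the lower right side (untilded
quantities), `tilde` is the upper left side (tilded quantities). -/
inductive Side
  | plain
  | tilde
  deriving DecidableEq

/-- The tilde-symmetry on sides. -/
def Side.other : Side → Side
  | plain => tilde
  | tilde => plain

/-- The function on sides with value `a` at `plain` and `b` at `tilde`. -/
def Side.pair {T : Type*} (a b : T) : Side → T
  | plain => a
  | tilde => b

/-- The expansion variables `ξ = (x, y, z, x̃, ỹ, z̃)`, where `N plain = r` and `N tilde = r̃`.
The variables `y` (resp. `ỹ`) are present only if `r̃ > 0` (resp. `r > 0`). -/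
inductive XiVar (N : Side → ℕ)
  | x (s : Side) (i : Fin (N s))
  | y (s : Side) (i : Fin (N s)) (h : 0 < N s.other)
  | z (s : Side) (i : Fin (N s - 1))

section Formal

variable {N : Side → ℕ}

/-! ### The system for the rescaled eigenvector components -/

/-- The variable `x_j` as a series (`0` outside its range of indices). -/
noncomputable def xS (N : Side → ℕ) (K : Type*) [Field K] (s : Side) (j : ℕ) :
    MvPowerSeries (XiVar N) K :=
  if h : j < N s then X (XiVar.x s ⟨j, h⟩) else 0

/-- The variable `y_j` as a series (`0` if there is no such variable). -/
noncomputable def yS (N : Side → ℕ) (K : Type*) [Field K] (s : Side) (j : ℕ) :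
    MvPowerSeries (XiVar N) K :=
  if h : j < N s ∧ 0 < N s.other then X (XiVar.y s ⟨j, h.1⟩ h.2) else 0

/-- The variable `z_j` as a series (`0` outside its range of indices, so `z_{r-1} = 0`). -/
noncomputable def zS (N : Side → ℕ) (K : Type*) [Field K] (s : Side) (j : ℕ) :
    MvPowerSeries (XiVar N) K :=
  if h : j < N s - 1 then X (XiVar.z s ⟨j, h⟩) else 0

/-- The component `u_n` on side `s`, where `u s i` stands for `u_{i+1}`, with `u_0 = 1`, and `0`
beyond the last component. -/
def comp {S : Type*} [Zero S] [One S] (u : (s : Side) → Fin (N s) → S) (s : Side) (n : ℕ) : S :=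
  if n = 0 then 1 else if h : n - 1 < N s then u s ⟨n - 1, h⟩ else 0

/-- The system `u_i = u_{i-1} - x_{i-1} u_1 u_i - y_{i-1} ũ_1 u_i + z_{i-1} u_{i+1}`,
`1 ≤ i ≤ r`, together with its tilded version, for formal power series in independent
variables `ξ`. -/
def SolvesRescaled {K : Type*} [Field K]
    (u : (s : Side) → Fin (N s) → MvPowerSeries (XiVar N) K) : Prop :=
  ∀ (s : Side) (i : Fin (N s)),
    comp u s (i + 1) = comp u s i
      - xS N K s i * comp u s 1 * comp u s (i + 1)
      - yS N K s i * comp u s.other 1 * comp u s (i + 1)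
      + zS N K s i * comp u s (i + 2)

/-- The monomial `u^k ũ^k̃` with integer exponents; `k s i` is the exponent of `u_{i+1}`. -/
def monomialUnits {S : Type*} [CommRing S] (U : (s : Side) → Fin (N s) → Sˣ)
    (k : (s : Side) → Fin (N s) → ℤ) : Sˣ :=
  (∏ i, U .plain i ^ k .plain i) * (∏ i, U .tilde i ^ k .tilde i)

/-! ### The hypergeometric series `Φ` -/

/-- The quadrinomial coefficient `a (a-1) ⋯ (a-m-n-p+1) / (m! n! p!)`, i.e. the coefficient of
`x^m y^n z^p` in `(1+x+y+z)^a`, for an integer `a`. -/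
def quadrinomial (K : Type*) [Field K] (a : ℤ) (m n p : ℕ) : K :=
  (∏ i ∈ Finset.range (m + n + p), ((a : K) - (i : K))) /
    ((m.factorial : K) * (n.factorial : K) * (p.factorial : K))

/-- The exponent `m_j` of `x_j` in `ξ^q`. -/
def mExp (q : XiVar N →₀ ℕ) (s : Side) (j : ℕ) : ℕ :=
  if h : j < N s then q (XiVar.x s ⟨j, h⟩) else 0

/-- The exponent `n_j` of `y_j` in `ξ^q`. -/
def nExp (q : XiVar N →₀ ℕ) (s : Side) (j : ℕ) : ℕ :=
  if h : j < N s ∧ 0 < N s.other then q (XiVar.y s ⟨j, h.1⟩ h.2) else 0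

/-- The exponent `p_j` of `z_j` in `ξ^q`, with `p_{r-1} = 0`. -/
def pExp (q : XiVar N →₀ ℕ) (s : Side) (j : ℕ) : ℕ :=
  if h : j < N s - 1 then q (XiVar.z s ⟨j, h⟩) else 0

/-- `|m| = m_0 + ⋯ + m_{r-1}`. -/
def mAbs (q : XiVar N →₀ ℕ) (s : Side) : ℕ := ∑ j ∈ Finset.range (N s), mExp q s j

/-- `|n| = n_0 + ⋯ + n_{r-1}`. -/
def nAbs (q : XiVar N →₀ ℕ) (s : Side) : ℕ := ∑ j ∈ Finset.range (N s), nExp q s j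

/-- `p_{j-1}`, where `p_{-1} = |m| + |ñ|`. -/
def pPrev (q : XiVar N →₀ ℕ) (s : Side) (j : ℕ) : ℕ :=
  if j = 0 then mAbs q s + nAbs q s.other else pExp q s (j - 1)

/-- The untilded (`s = plain`) or tilded (`s = tilde`) product of quadrinomial coefficients in
the coefficient of `Φ(ξ; μ, μ̃)` at `ξ^q`. -/
def phiFactor (K : Type*) [Field K] (μ : (s : Side) → ℕ → ℤ) (q : XiVar N →₀ ℕ)
    (s : Side) : K :=
  ∏ j ∈ Finset.range (N s),
    quadrinomial K
      (μ s j + mExp q s j + nExp q s j + pPrev q s j + pExp q s j - 1)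
      (mExp q s j) (nExp q s j) (pExp q s j)

/-- The formal power series `Φ(ξ; μ, μ̃)`, given by its coefficients. Only the values `μ s j` with
`j < N s` matter. -/
def Phi (K : Type*) [Field K] (μ : (s : Side) → ℕ → ℤ) : MvPowerSeries (XiVar N) K :=
  fun q =>
    (-1) ^ (mAbs q .plain + nAbs q .plain + mAbs q .tilde + nAbs q .tilde) *
      phiFactor K μ q .plain * phiFactor K μ q .tilde

/-! ### The expansion -/

/-- The Kronecker symbol `δ_{ij}`. -/
def delta (i j : ℤ) : ℕ := if i = j then 1 else 0

/-- The step function `σ_{ij}`, equal to `1` if `i > j` and to `0` otherwise. -/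
def stepF (i j : ℤ) : ℕ := if j < i then 1 else 0

/-- The monomial `ξ^{𝔣_i} = ∏_j x_j^{δ_{ij}} z_j^{σ_{ij}}`. -/
noncomputable def xiF (N : Side → ℕ) (K : Type*) [Field K] (s : Side) (i : ℤ) :
    MvPowerSeries (XiVar N) K :=
  ∏ j ∈ Finset.range (N s), xS N K s j ^ delta i j * zS N K s j ^ stepF i j

/-- The monomial `ξ^{𝔤_i} = ∏_j y_j^{δ_{ij}} z_j^{σ_{ij}}`. -/
noncomputable def xiG (N : Side → ℕ) (K : Type*) [Field K] (s : Side) (i : ℤ) :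
    MvPowerSeries (XiVar N) K :=
  ∏ j ∈ Finset.range (N s), yS N K s j ^ delta i j * zS N K s j ^ stepF i j

/-- `π_j = k_{j+1} + ⋯ + k_r`, where `k s l` stands for `k_{l+1}`. -/
def piPar (k : (s : Side) → Fin (N s) → ℤ) (s : Side) (j : ℕ) : ℤ :=
  ∑ l : Fin (N s), if j ≤ (l : ℕ) then k s l else 0

/-- `ν^i_j = 2 σ_{i,j-1}`. -/
def nuPar (i : ℤ) (j : ℕ) : ℤ := 2 * (stepF i ((j : ℤ) - 1) : ℤ)

/-- `Φ(ξ; π + ν^i, π̃ + ν̃^ι)`. -/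
def phiTerm (K : Type*) [Field K] (k : (s : Side) → Fin (N s) → ℤ) (i ι : ℤ) :
    MvPowerSeries (XiVar N) K :=
  Phi K fun s j => piPar k s j + nuPar (Side.pair i ι s) j

/-- The right-hand side of the expansion of `u^k ũ^k̃`. -/
noncomputable def phiExpansion (K : Type*) [Field K] (k : (s : Side) → Fin (N s) → ℤ) :
    MvPowerSeries (XiVar N) K :=
  (∑ i ∈ Finset.Icc (-1 : ℤ) ((N .plain : ℤ) - 1),
    ∑ ι ∈ Finset.Icc (-1 : ℤ) ((N .tilde : ℤ) - 1),
      xiF N K .plain i * xiF N K .tilde ι * phiTerm K k i ι)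
  - ∑ i ∈ Finset.Icc (0 : ℤ) ((N .plain : ℤ) - 1),
      ∑ ι ∈ Finset.Icc (0 : ℤ) ((N .tilde : ℤ) - 1),
        xiG N K .plain i * xiG N K .tilde ι * phiTerm K k i ι

/-- The exponent vector whose only nonzero entry is a `1` at `u_{i+1}` on side `s`. -/
def unitExp (s : Side) (i : Fin (N s)) : (t : Side) → Fin (N t) → ℤ :=
  Pi.single s (Pi.single i 1)

end Formal

/-! ### The spectral problem of the Jacobi matrix -/

section Spectral

/-- The off-diagonal entries `β` (superdiagonal) and `γ` (subdiagonal) of the matrix, which are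
independent variables. -/
inductive OffVar (N : Side → ℕ)
  | beta (i : Fin (N .tilde + N .plain))
  | gamma (i : Fin (N .tilde + N .plain))

/-- The order `d = r̃ + 1 + r` of the matrix. -/
abbrev dim (N : Side → ℕ) : ℕ := N .tilde + 1 + N .plain

variable {N : Side → ℕ} {K : Type*} [Field K]

/-- The Jacobi matrix with diagonal `α`, superdiagonal `β` and subdiagonal `γ`. -/
noncomputable def jacobiMatrix (α : Fin (dim N) → K) :
    Matrix (Fin (dim N)) (Fin (dim N)) (MvPowerSeries (OffVar N) K) :=
  fun i j =>
    if i = j then C (α i)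
    else if h : (i : ℕ) + 1 = j then X (.beta ⟨i, by have := j.isLt; unfold dim at this; omega⟩)
    else if h : (j : ℕ) + 1 = i then X (.gamma ⟨j, by have := i.isLt; unfold dim at this; omega⟩)
    else 0

/-- The position of the distinguished diagonal entry (`k = r̃ + 1`, counted from `0` here). -/
def center (N : Side → ℕ) : Fin (dim N) := ⟨N .tilde, by unfold dim; omega⟩

/-- The position at distance `i + 1` from the distinguished one, on side `s`. -/
def node : (s : Side) → Fin (N s) → Fin (dim N)
  | .plain, i => ⟨N .tilde + (i + 1), by have := i.isLt; unfold dim; omega⟩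
  | .tilde, i => ⟨N .tilde - (i + 1), by unfold dim; omega⟩

/-- `Λ` and `V` form an eigenpair of the Jacobi matrix, normalised by `V_k = 1`, on the branch
`Λ = α_k + …`, `V_j = 0 + …` for `j ≠ k`. -/
def IsEigenBranch (α : Fin (dim N) → K) (Λ : MvPowerSeries (OffVar N) K)
    (V : Fin (dim N) → MvPowerSeries (OffVar N) K) : Prop :=
  (jacobiMatrix α).mulVec V = Λ • V ∧ V (center N) = 1 ∧
    constantCoeff Λ = α (center N) ∧ ∀ j, j ≠ center N → constantCoeff (V j) = 0

/-- `a_{i+1}` on the plain side and `ã_{i+1}` on the tilde side, the diagonal entry relative to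
the distinguished one. -/
def diagDiff (α : Fin (dim N) → K) (s : Side) (i : Fin (N s)) : K :=
  α (node s i) - α (center N)

/-- `b_i = β_{k+i}` on the plain side and `c̃_i = γ_{k-1-i}` on the tilde side: the matrix
entry that couples the equation at distance `i` to the component at distance `i + 1`. -/
noncomputable def outward (K : Type*) [Field K] :
    (s : Side) → Fin (N s) → MvPowerSeries (OffVar N) K
  | .plain, i => X (.beta ⟨N .tilde + i, by have := i.isLt; omega⟩)
  | .tilde, i => X (.gamma ⟨N .tilde - 1 - i, by have := i.isLt; omega⟩)

/-- `c_i = γ_{k+i}` on the plain side and `b̃_i = β_{k-1-i}` on the tilde side: the matrix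
entry that couples the equation at distance `i + 1` to the component at distance `i`. -/
noncomputable def inward (K : Type*) [Field K] :
    (s : Side) → Fin (N s) → MvPowerSeries (OffVar N) K
  | .plain, i => X (.gamma ⟨N .tilde + i, by have := i.isLt; omega⟩)
  | .tilde, i => X (.beta ⟨N .tilde - 1 - i, by have := i.isLt; omega⟩)

/-- The values of the variables `ξ` in terms of the matrix entries:
`x_i = b_0 c_0 / (a_1 a_{i+1})`, `y_i = b̃_0 c̃_0 / (ã_1 a_{i+1})`,
`z_i = b_{i+1} c_{i+1} / (a_{i+1} a_{i+2})`, and the tilded versions. -/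
noncomputable def xiVal (α : Fin (dim N) → K) : XiVar N → MvPowerSeries (OffVar N) K
  | .x s i =>
      C (1 / (diagDiff α s ⟨0, i.pos⟩ * diagDiff α s i)) *
        (outward K s ⟨0, i.pos⟩ * inward K s ⟨0, i.pos⟩)
  | .y s i h =>
      C (1 / (diagDiff α s.other ⟨0, h⟩ * diagDiff α s i)) *
        (outward K s.other ⟨0, h⟩ * inward K s.other ⟨0, h⟩)
  | .z s i =>
      C (1 / (diagDiff α s ⟨i, by have := i.isLt; omega⟩ *
          diagDiff α s ⟨i + 1, by have := i.isLt; omega⟩)) *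
        (outward K s ⟨i + 1, by have := i.isLt; omega⟩ *
          inward K s ⟨i + 1, by have := i.isLt; omega⟩)

/-- The scaling factor of the component at distance `i + 1`:
`v_{i+1}^0 = (-1)^{i+1} c_0 ⋯ c_i / (a_1 ⋯ a_{i+1})`, with `b̃` and `ã` in place of `c` and `a` on
the tilde side. -/
noncomputable def scaleFactor (α : Fin (dim N) → K) (s : Side) (i : Fin (N s)) :
    MvPowerSeries (OffVar N) K :=
  C ((-1) ^ ((i : ℕ) + 1) / ∏ j ∈ Finset.Iic i, diagDiff α s j) *
    ∏ j ∈ Finset.Iic i, inward K s j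

/-- `b_0 v_1` on the plain side and `c̃_0 ṽ_1` on the tilde side, where `v s i` stands for the
component at distance `i + 1`; it is `0` if the side is empty. -/
noncomputable def couplingTerm (v : (s : Side) → Fin (N s) → MvPowerSeries (OffVar N) K)
    (s : Side) : MvPowerSeries (OffVar N) K :=
  if h : 0 < N s then outward K s ⟨0, h⟩ * v s ⟨0, h⟩ else 0

/-- The series for the eigenvector component at distance `i + 1` on side `s`. -/
noncomputable def componentSeries (α : Fin (dim N) → K) (s : Side) (i : Fin (N s)) :
    MvPowerSeries (OffVar N) K :=
  scaleFactor α s i * subst (xiVal α) (phiExpansion K (unitExp s i))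

/-- There are finitely many variables `ξ`. -/
instance finite_xiVar (N : Side → ℕ) : Finite (XiVar N) := by
  have hs : Finite Side := Finite.of_injective (fun s : Side => decide (s = .plain)) (by
    intro a b; cases a <;> cases b <;> simp)
  let e : XiVar N → (Σ s : Side, Fin (N s)) ⊕ (Σ s : Side, Fin (N s)) ⊕
      (Σ s : Side, Fin (N s - 1)) := fun
    | .x s i => .inl ⟨s, i⟩
    | .y s i _ => .inr (.inl ⟨s, i⟩)
    | .z s i => .inr (.inr ⟨s, i⟩)
  refine Finite.of_injective e ?_
  intro a b h
  cases a <;> cases b <;> simp [e] at h <;> obtain ⟨rfl, h⟩ := h <;> simp_all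

/-- Substituting the values of `ξ` into a formal power series is meaningful. -/
theorem hasSubst_xiVal (α : Fin (dim N) → K) : HasSubst (xiVal α) := by
  have hin : ∀ (s : Side) (i : Fin (N s)), constantCoeff (inward K s i) = 0 := by
    intro s i; cases s <;> simp [inward]
  refine hasSubst_of_constantCoeff_zero fun v => ?_
  cases v <;> simp [xiVal, hin]

end Spectral

end JacobiSpectral

open JacobiSpectral

namespace JacobiSpectral

open MvPowerSeries

/-! Put $w_j=u_{j+1}/u_j$ on each side. Dividing the $i$-th equation of the system by $u_i$ gives
$w_{i-1}^{-1}=1+x_{i-1}w_0+y_{i-1}\tilde w_0-z_{i-1}w_i$, so the system says that the monomials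
$w^\mu$ satisfy linear relations in $\mu$, recorded as `IsTower`. A family satisfying these
relations is determined by its value at $\mu=0$ (`IsTower.eq_zero`): every shift of $\mu$ changes it
only by terms of higher order.

The series $\Phi(\mu)$ satisfy the same relations (`isTower_phiSeries`): the factors of its
coefficients are coefficients of $(1+X+Y-Z)^{-A}$, and multiplying by $1+X+Y-Z$ is the required
Pascal rule `negQuad_pred`. Uniqueness then forces
$\Phi(\mu+\lambda)\Phi(0)=\Phi(\mu)\Phi(\lambda)$. Hence $\mu\mapsto\Phi(\mu)/\Phi(0)$ is a
homomorphism into the units; its values are the monomials $w^\mu$, and $u_i=w_0\cdots w_{i-1}$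
solves the system.

Since $u^{\mathbf k}\tilde u^{\tilde{\mathbf k}}=w^{(\pi,\tilde\pi)}$ and
$\Phi(\pi+\nu)=w^\pi\Phi(\nu)$ on both sides jointly, the expansion equals $w^\pi E_0$. What remains
is $E_0=1$ (`phiExpansion_zero`): coefficientwise it factors over the two sides, and each sum
telescopes (`prevExp_mul_fCoef`, `prevExp_mul_gCoef`, `coef_normalisation`).

For the matrix, the centre row expresses $\lambda$ through $v_1,\tilde v_1$. Scaling the other
components by their leading terms turns the remaining rows into the rescaled system at the
substituted $\xi$ (`isEigenBranch_of_solvesRescaled`). Uniqueness of the branch is again an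
induction on order, using that the differences $a_i,\tilde a_i$ are nonzero. -/

/-- The coefficient of `X^m Y^n Z^p` in `(1 + X + Y - Z)^(-A)`, extended by `0` to integer
exponents. -/
noncomputable def negQuad (K : Type*) [Field K] (A m n p : ℤ) : K :=
  if 0 ≤ m ∧ 0 ≤ n ∧ 0 ≤ p then
    (-1) ^ (m.toNat + n.toNat) * (∏ i ∈ Finset.range (m.toNat + n.toNat + p.toNat), ((A : K) + i)) /
      (m.toNat.factorial * n.toNat.factorial * p.toNat.factorial)
  else 0

/-! ### Coefficients of $(1+X+Y-Z)^{-A}$ and their recurrences -/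

section NegQuad

variable {K : Type*} [Field K]

theorem negQuad_natCast (A : ℤ) (m n p : ℕ) :
    negQuad K A m n p = (-1) ^ (m + n) * (∏ i ∈ Finset.range (m + n + p), ((A : K) + i)) /
      (m.factorial * n.factorial * p.factorial) := by
  simp [negQuad]

theorem negQuad_of_neg {A m n p : ℤ} (h : m < 0 ∨ n < 0 ∨ p < 0) : negQuad K A m n p = 0 := by
  rw [negQuad, if_neg (by omega)]

/-- A falling product starting at $A+m+n+p-1$ is the rising product starting at $A$, read backwards.
The quadrinomials in $\Phi$ have this shape with $A=\mu_j+p_{j-1}$. -/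
theorem negQuad_eq_quadrinomial (A : ℤ) (m n p : ℕ) :
    negQuad K A m n p = (-1) ^ (m + n) * quadrinomial K (A + m + n + p - 1) m n p := by
  rw [negQuad_natCast, quadrinomial, mul_div_assoc]
  congr 2
  rw [← Finset.prod_range_reflect]
  refine Finset.prod_congr rfl fun i hi => ?_
  have hi' := Finset.mem_range.1 hi
  rw [Nat.sub_sub, Nat.cast_sub (by omega)]
  push_cast
  ring

theorem prod_range_add_succ_left (A : ℤ) (S : ℕ) :
    ∏ i ∈ Finset.range (S + 1), ((A : K) + i) =
      A * ∏ i ∈ Finset.range S, (((A + 1 : ℤ) : K) + i) := by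
  rw [Finset.prod_range_succ', mul_comm]
  simp [add_comm, add_left_comm]

theorem negQuad_swap (A m n p : ℤ) : negQuad K A m n p = negQuad K A n m p := by
  refine if_congr (by tauto) ?_ rfl
  rw [add_comm m.toNat, mul_comm (m.toNat.factorial : K)]

/-- For $A=0$ the generating series is the constant $1$. -/
theorem negQuad_zero_zero (m n p : ℤ) (h : negQuad K 0 m n p ≠ 0) : m = 0 ∧ n = 0 ∧ p = 0 := by
  by_cases h' : m < 0 ∨ n < 0 ∨ p < 0
  · exact absurd (negQuad_of_neg h') h
  obtain ⟨m, rfl⟩ := Int.eq_ofNat_of_zero_le (a := m) (by omega)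
  obtain ⟨n, rfl⟩ := Int.eq_ofNat_of_zero_le (a := n) (by omega)
  obtain ⟨p, rfl⟩ := Int.eq_ofNat_of_zero_le (a := p) (by omega)
  rcases h' : m + n + p with _ | S
  · omega
  · refine absurd ?_ h
    rw [negQuad_natCast, h', prod_range_add_succ_left]
    simp

variable [CharZero K]

/-- Coefficient form of $\partial_Z(1+X+Y-Z)^{-A}=A(1+X+Y-Z)^{-A-1}$; the next two lemmas use
$\partial_X$ and $\partial_Y$, whence their sign. -/
theorem mul_negQuad_z (A m n p : ℤ) :
    (p : K) * negQuad K A m n p = A * negQuad K (A + 1) m n (p - 1) := by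
  by_cases h : m < 0 ∨ n < 0 ∨ p < 0
  · rw [negQuad_of_neg h, negQuad_of_neg (by omega)]; simp
  obtain ⟨m, rfl⟩ := Int.eq_ofNat_of_zero_le (a := m) (by omega)
  obtain ⟨n, rfl⟩ := Int.eq_ofNat_of_zero_le (a := n) (by omega)
  obtain ⟨p, rfl⟩ := Int.eq_ofNat_of_zero_le (a := p) (by omega)
  rcases p with _ | p
  · rw [negQuad_of_neg (A := A + 1) (by simp)]; simp
  · have e : ((p + 1 : ℕ) : ℤ) - 1 = (p : ℕ) := by push_cast; ring
    rw [e, negQuad_natCast, negQuad_natCast, ← add_assoc (m + n), prod_range_add_succ_left,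
      Nat.factorial_succ]
    have hm : (m.factorial : K) ≠ 0 := by exact_mod_cast m.factorial_ne_zero
    have hn : (n.factorial : K) ≠ 0 := by exact_mod_cast n.factorial_ne_zero
    have hp : (p.factorial : K) ≠ 0 := by exact_mod_cast p.factorial_ne_zero
    have hp' : (p : K) + 1 ≠ 0 := by exact_mod_cast p.succ_ne_zero
    push_cast
    field_simp

theorem mul_negQuad_x (A m n p : ℤ) :
    (m : K) * negQuad K A m n p = -(A * negQuad K (A + 1) (m - 1) n p) := by
  by_cases h : m < 0 ∨ n < 0 ∨ p < 0
  · rw [negQuad_of_neg h, negQuad_of_neg (by omega)]; simp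
  obtain ⟨m, rfl⟩ := Int.eq_ofNat_of_zero_le (a := m) (by omega)
  obtain ⟨n, rfl⟩ := Int.eq_ofNat_of_zero_le (a := n) (by omega)
  obtain ⟨p, rfl⟩ := Int.eq_ofNat_of_zero_le (a := p) (by omega)
  rcases m with _ | m
  · rw [negQuad_of_neg (A := A + 1) (by simp)]; simp
  · have e : ((m + 1 : ℕ) : ℤ) - 1 = (m : ℕ) := by push_cast; ring
    rw [e, negQuad_natCast, negQuad_natCast, show m + 1 + n + p = m + n + p + 1 by omega,
      show m + 1 + n = m + n + 1 by omega, prod_range_add_succ_left, Nat.factorial_succ, pow_succ]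
    have hm : (m.factorial : K) ≠ 0 := by exact_mod_cast m.factorial_ne_zero
    have hn : (n.factorial : K) ≠ 0 := by exact_mod_cast n.factorial_ne_zero
    have hp : (p.factorial : K) ≠ 0 := by exact_mod_cast p.factorial_ne_zero
    have hp' : (m : K) + 1 ≠ 0 := by exact_mod_cast m.succ_ne_zero
    push_cast
    field_simp

theorem mul_negQuad_y (A m n p : ℤ) :
    (n : K) * negQuad K A m n p = -(A * negQuad K (A + 1) m (n - 1) p) := by
  rw [negQuad_swap, mul_negQuad_x, negQuad_swap]

/-- Pascal rule: $(1+X+Y-Z)^{-(A-1)}$ is $(1+X+Y-Z)$ times $(1+X+Y-Z)^{-A}$. -/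
theorem negQuad_pred (A m n p : ℤ) :
    negQuad K (A - 1) m n p = negQuad K A m n p + negQuad K A (m - 1) n p
      + negQuad K A m (n - 1) p - negQuad K A m n (p - 1) := by
  by_cases h : m < 0 ∨ n < 0 ∨ p < 0
  · rw [negQuad_of_neg h, negQuad_of_neg h, negQuad_of_neg (by omega), negQuad_of_neg (by omega),
      negQuad_of_neg (by omega)]
    simp
  obtain ⟨m, rfl⟩ := Int.eq_ofNat_of_zero_le (a := m) (by omega)
  obtain ⟨n, rfl⟩ := Int.eq_ofNat_of_zero_le (a := n) (by omega)
  obtain ⟨p, rfl⟩ := Int.eq_ofNat_of_zero_le (a := p) (by omega)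
  -- All terms are brought over the denominator $m!\,n!\,p!$. After removal of the common product
  -- the claim is $m+n+p=S+1$, where $S$ is the number of remaining factors.
  have hx (m n p : ℕ) : negQuad K A (m - 1) n p = -((-1) ^ (m + n) * (m *
      ∏ i ∈ Finset.range (m + n + p - 1), ((A : K) + i)) /
        (m.factorial * n.factorial * p.factorial)) := by
    rcases m with _ | m
    · rw [negQuad_of_neg (by simp)]; simp
    · rw [show ((m + 1 : ℕ) : ℤ) - 1 = (m : ℕ) by push_cast; ring, negQuad_natCast,
        show m + 1 + n + p - 1 = m + n + p by omega, show m + 1 + n = m + n + 1 by omega,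
        Nat.factorial_succ, pow_succ]
      have hm : (m.factorial : K) ≠ 0 := by exact_mod_cast m.factorial_ne_zero
      have hp' : (m : K) + 1 ≠ 0 := by exact_mod_cast m.succ_ne_zero
      push_cast
      field_simp
  have hz : negQuad K A m n (p - 1) = (-1) ^ (m + n) * (p *
      ∏ i ∈ Finset.range (m + n + p - 1), ((A : K) + i)) /
        (m.factorial * n.factorial * p.factorial) := by
    rcases p with _ | p
    · rw [negQuad_of_neg (by simp)]; simp
    · rw [show ((p + 1 : ℕ) : ℤ) - 1 = (p : ℕ) by push_cast; ring, negQuad_natCast,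
        show m + n + (p + 1) - 1 = m + n + p by omega, Nat.factorial_succ]
      have hm : (p.factorial : K) ≠ 0 := by exact_mod_cast p.factorial_ne_zero
      have hp' : (p : K) + 1 ≠ 0 := by exact_mod_cast p.succ_ne_zero
      push_cast
      field_simp
  rw [hx, negQuad_swap A m (n - 1), hx, hz, negQuad_natCast, negQuad_natCast]
  rcases h : m + n + p with _ | S
  · obtain ⟨rfl, rfl, rfl⟩ : m = 0 ∧ n = 0 ∧ p = 0 := by omega
    simp
  · have hS : (m : K) + n + p = S + 1 := by exact_mod_cast h
    rw [show n + m + p = S + 1 by omega, Nat.add_sub_cancel, prod_range_add_succ_left,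
      Finset.prod_range_succ, add_comm n m, mul_comm (n.factorial : K), sub_add_cancel]
    push_cast
    linear_combination ((-1) ^ (m + n) * (∏ i ∈ Finset.range S, ((A : K) + i)) /
      (m.factorial * n.factorial * p.factorial)) * hS

end NegQuad

/-! ### Filtration of power series by order -/

section OrderIdeal

variable {σ K : Type*} [Field K]

/-- The power series of order at least `n`. -/
def orderIdeal (σ K : Type*) [Field K] (n : ℕ) : Ideal (MvPowerSeries σ K) where
  carrier := {f | (n : ℕ∞) ≤ f.order}
  zero_mem' := by simp
  add_mem' ha hb := (le_min ha hb).trans min_order_le_add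
  smul_mem' c _ hf := (show _ ≤ _ from hf).trans ((le_add_self).trans (le_order_mul (f := c)))

theorem mem_orderIdeal {n : ℕ} {f : MvPowerSeries σ K} :
    f ∈ orderIdeal σ K n ↔ (n : ℕ∞) ≤ f.order := Iff.rfl

theorem mem_orderIdeal_zero (f : MvPowerSeries σ K) : f ∈ orderIdeal σ K 0 := by
  simp [mem_orderIdeal]

/-- The gain of one order that drives every uniqueness argument below. -/
theorem mul_mem_orderIdeal_succ {n : ℕ} {f g : MvPowerSeries σ K} (hf : constantCoeff f = 0)
    (hg : g ∈ orderIdeal σ K n) : f * g ∈ orderIdeal σ K (n + 1) := by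
  refine le_trans ?_ le_order_mul
  rw [add_comm n 1]
  push_cast
  exact add_le_add (one_le_order_iff_constCoeff_eq_zero.2 hf) hg

theorem eq_zero_of_forall_mem_orderIdeal {f : MvPowerSeries σ K}
    (h : ∀ n, f ∈ orderIdeal σ K n) : f = 0 := by
  rw [← order_eq_top_iff]
  exact ENat.eq_top_iff_forall_ge.2 h

end OrderIdeal

instance : Fintype Side := ⟨{.plain, .tilde}, fun s => by cases s <;> simp⟩

theorem Side.prod_univ {M : Type*} [CommMonoid M] (f : Side → M) :
    ∏ s, f s = f .plain * f .tilde := by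
  rw [show (Finset.univ : Finset Side) = {.plain, .tilde} from rfl, Finset.prod_pair (by simp)]

theorem Side.other_other (s : Side) : s.other.other = s := by cases s <;> rfl

/-- The positions off the centre: `⟨s, i⟩` is at distance `i + 1` on side `s`. -/
abbrev Idx (N : Side → ℕ) := Σ s : Side, Fin (N s)

/-! ### Integer exponent vectors and the coefficients of $\Phi$ -/

section Exponents

variable {N : Side → ℕ}

/-- The exponent of `x_j` in an integer exponent vector. -/
def xExp (q : XiVar N → ℤ) (s : Side) (j : ℕ) : ℤ :=
  if h : j < N s then q (.x s ⟨j, h⟩) else 0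

/-- The exponent of `y_j` in an integer exponent vector. -/
def yExp (q : XiVar N → ℤ) (s : Side) (j : ℕ) : ℤ :=
  if h : j < N s ∧ 0 < N s.other then q (.y s ⟨j, h.1⟩ h.2) else 0

/-- The exponent of `z_j` in an integer exponent vector. -/
def zExp (q : XiVar N → ℤ) (s : Side) (j : ℕ) : ℤ :=
  if h : j < N s - 1 then q (.z s ⟨j, h⟩) else 0

/-- The exponent `p_{j-1}` of an integer exponent vector, with `p_{-1} = |m| + |ñ|`. -/
def prevExp (q : XiVar N → ℤ) (s : Side) (j : ℕ) : ℤ :=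
  if j = 0 then
    ∑ i ∈ Finset.range (N s), xExp q s i + ∑ i ∈ Finset.range (N s.other), yExp q s.other i
  else zExp q s (j - 1)

theorem xExp_sub (q v : XiVar N → ℤ) (s : Side) (j : ℕ) :
    xExp (q - v) s j = xExp q s j - xExp v s j := by
  unfold xExp; split <;> simp

theorem yExp_sub (q v : XiVar N → ℤ) (s : Side) (j : ℕ) :
    yExp (q - v) s j = yExp q s j - yExp v s j := by
  unfold yExp; split <;> simp

theorem zExp_sub (q v : XiVar N → ℤ) (s : Side) (j : ℕ) :
    zExp (q - v) s j = zExp q s j - zExp v s j := by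
  unfold zExp; split <;> simp

theorem prevExp_sub (q v : XiVar N → ℤ) (s : Side) (j : ℕ) :
    prevExp (q - v) s j = prevExp q s j - prevExp v s j := by
  unfold prevExp
  split
  · simp only [xExp_sub, yExp_sub, Finset.sum_sub_distrib]; ring
  · exact zExp_sub ..

/-- The exponent vector with the given exponents of `x_j`, `y_j` and `z_j`. -/
noncomputable def expVec (N : Side → ℕ) (a b c : Side → ℕ → ℕ) : XiVar N →₀ ℕ :=
  Finsupp.equivFunOnFinite.symm fun
    | .x s i => a s i
    | .y s i _ => b s i
    | .z s i => c s i

/-- The integer exponent vector of a monomial. -/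
def castExp (q : XiVar N →₀ ℕ) : XiVar N → ℤ := fun v => q v

theorem xExp_expVec (a b c : Side → ℕ → ℕ) (s : Side) (j : ℕ) :
    xExp (castExp (expVec N a b c)) s j = if j < N s then (a s j : ℤ) else 0 := by
  unfold xExp; split <;> simp [castExp, expVec]

theorem yExp_expVec (a b c : Side → ℕ → ℕ) (s : Side) (j : ℕ) :
    yExp (castExp (expVec N a b c)) s j = if j < N s ∧ 0 < N s.other then (b s j : ℤ) else 0 := by
  unfold yExp; split <;> simp [castExp, expVec]

theorem zExp_expVec (a b c : Side → ℕ → ℕ) (s : Side) (j : ℕ) :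
    zExp (castExp (expVec N a b c)) s j = if j < N s - 1 then (c s j : ℤ) else 0 := by
  unfold zExp; split <;> simp [castExp, expVec]

theorem expVec_add (a b c a' b' c' : Side → ℕ → ℕ) :
    expVec N a b c + expVec N a' b' c' = expVec N (a + a') (b + b') (c + c') := by
  ext v; cases v <;> simp [expVec]

theorem expVec_sum {ι : Type*} (S : Finset ι) (a b c : ι → Side → ℕ → ℕ) :
    ∑ i ∈ S, expVec N (a i) (b i) (c i) = expVec N (∑ i ∈ S, a i) (∑ i ∈ S, b i) (∑ i ∈ S, c i) := by
  ext v; cases v <;> simp [expVec, Finsupp.finsetSum_apply]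

/-- The indicator function of the position `j` on side `s`, times `n`. -/
def spot (s : Side) (j n : ℕ) : Side → ℕ → ℕ := fun s' j' => if s' = s ∧ j' = j then n else 0

variable (K : Type*) [Field K]

theorem xS_pow {s : Side} {j : ℕ} (h : j < N s) (n : ℕ) :
    xS N K s j ^ n = monomial (expVec N (spot s j n) 0 0) 1 := by
  classical
  rw [xS, dif_pos h, X_pow_eq]
  congr 1
  congr 1
  ext v
  cases v with
  | x s' i =>
    by_cases hs : s' = s
    · subst hs
      simp [expVec, spot, Finsupp.single_apply, Fin.ext_iff, eq_comm]
    · simp [expVec, spot, hs]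
  | y s' i _ => simp [expVec]
  | z s' i => simp [expVec]

theorem yS_pow {s : Side} {j : ℕ} (h : j < N s ∧ 0 < N s.other) (n : ℕ) :
    yS N K s j ^ n = monomial (expVec N 0 (spot s j n) 0) 1 := by
  classical
  rw [yS, dif_pos h, X_pow_eq]
  congr 1
  congr 1
  ext v
  cases v with
  | y s' i _ =>
    by_cases hs : s' = s
    · subst hs
      simp [expVec, spot, Finsupp.single_apply, Fin.ext_iff, eq_comm]
    · simp [expVec, spot, hs]
  | x s' i => simp [expVec]
  | z s' i => simp [expVec]

theorem zS_pow {s : Side} {j : ℕ} (h : j < N s - 1) (n : ℕ) :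
    zS N K s j ^ n = monomial (expVec N 0 0 (spot s j n)) 1 := by
  classical
  rw [zS, dif_pos h, X_pow_eq]
  congr 1
  congr 1
  ext v
  cases v with
  | z s' i =>
    by_cases hs : s' = s
    · subst hs
      simp [expVec, spot, Finsupp.single_apply, Fin.ext_iff, eq_comm]
    · simp [expVec, spot, hs]
  | x s' i => simp [expVec]
  | y s' i _ => simp [expVec]

/-- The factor at position `t` of the coefficient of `Φ(ξ; μ, μ̃)` at an integer exponent vector. -/
noncomputable def phiCoefAt (μ : Idx N → ℤ) (q : XiVar N → ℤ) (t : Idx N) : K :=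
  negQuad K (μ t + prevExp q t.1 t.2) (xExp q t.1 t.2) (yExp q t.1 t.2) (zExp q t.1 t.2)

/-- The coefficient of `Φ(ξ; μ, μ̃)` at an integer exponent vector. -/
noncomputable def phiCoef (μ : Idx N → ℤ) (q : XiVar N → ℤ) : K := ∏ t, phiCoefAt K μ q t

/-- Allowing negative exponents, with coefficient zero there, makes multiplication by a monomial a
plain translation of the exponent, without a divisibility condition. -/
theorem phiCoef_eq_zero (μ : Idx N → ℤ) {q : XiVar N → ℤ} {v : XiVar N} (h : q v < 0) :
    phiCoef K μ q = 0 := by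
  cases v with
  | x s i =>
    refine Finset.prod_eq_zero (Finset.mem_univ ⟨s, i⟩) (negQuad_of_neg (.inl ?_))
    simpa [xExp] using h
  | y s i hs =>
    refine Finset.prod_eq_zero (Finset.mem_univ ⟨s, i⟩) (negQuad_of_neg (.inr (.inl ?_)))
    simpa [yExp, hs] using h
  | z s i =>
    refine Finset.prod_eq_zero (Finset.mem_univ ⟨s, ⟨i, by omega⟩⟩)
      (negQuad_of_neg (.inr (.inr ?_)))
    simpa [zExp] using h

theorem xExp_castExp (q : XiVar N →₀ ℕ) (s : Side) (j : ℕ) :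
    xExp (castExp q) s j = mExp q s j := by
  unfold xExp mExp; split <;> simp [castExp]

theorem yExp_castExp (q : XiVar N →₀ ℕ) (s : Side) (j : ℕ) :
    yExp (castExp q) s j = nExp q s j := by
  unfold yExp nExp; split <;> simp [castExp]

theorem zExp_castExp (q : XiVar N →₀ ℕ) (s : Side) (j : ℕ) :
    zExp (castExp q) s j = pExp q s j := by
  unfold zExp pExp; split <;> simp [castExp]

theorem prevExp_castExp (q : XiVar N →₀ ℕ) (s : Side) (j : ℕ) :
    prevExp (castExp q) s j = pPrev q s j := by
  unfold prevExp pPrev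
  split <;> simp [xExp_castExp, yExp_castExp, zExp_castExp, mAbs, nAbs]

theorem coeff_Phi (μ : Side → ℕ → ℤ) (q : XiVar N →₀ ℕ) :
    coeff q (Phi K μ) = phiCoef K (fun t => μ t.1 t.2) (castExp q) := by
  have key (s : Side) : ∏ i : Fin (N s), phiCoefAt K (fun t => μ t.1 t.2) (castExp q) ⟨s, i⟩ =
      (-1) ^ (mAbs q s + nAbs q s) * phiFactor K μ q s := by
    rw [phiFactor, mAbs, nAbs, ← Finset.sum_add_distrib, ← Finset.prod_pow_eq_pow_sum,
      ← Finset.prod_mul_distrib, ← Fin.prod_univ_eq_prod_range]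
    refine Finset.prod_congr rfl fun i _ => ?_
    rw [phiCoefAt, xExp_castExp, yExp_castExp, zExp_castExp, prevExp_castExp,
      negQuad_eq_quadrinomial]
    congr 2
    ring
  rw [phiCoef, ← Finset.univ_sigma_univ, Finset.prod_sigma, Side.prod_univ, key, key]
  rw [show coeff q (Phi K μ) = Phi K μ q from rfl, Phi,
    show mAbs q .plain + nAbs q .plain + mAbs q .tilde + nAbs q .tilde =
    (mAbs q .plain + nAbs q .plain) + (mAbs q .tilde + nAbs q .tilde) by ring, pow_add]
  ring

theorem coeff_monomial_mul_Phi (v : XiVar N →₀ ℕ) (μ : Side → ℕ → ℤ) (q : XiVar N →₀ ℕ) :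
    coeff q (monomial v 1 * Phi K μ) =
      phiCoef K (fun t => μ t.1 t.2) (castExp q - castExp v) := by
  rw [coeff_monomial_mul]
  split_ifs with h
  · rw [one_mul, coeff_Phi]
    congr 1
    ext w
    have := h w
    simp [castExp, Nat.cast_sub this]
  · obtain ⟨w, hw⟩ : ∃ w, q w < v w := by
      simpa [Finsupp.le_def] using h
    rw [phiCoef_eq_zero K (v := w)]
    simpa [castExp] using hw

end Exponents

/-! ### Linear relations for the monomials $w^\mu$, and their unique solvability -/

section Tower

variable {N : Side → ℕ} (K : Type*) [Field K]

/-- The unit vector at position `j` of side `s` (zero if there is no such position). -/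
def unitAt (N : Side → ℕ) (s : Side) (j : ℕ) : Idx N → ℤ :=
  fun t => if t.1 = s ∧ (t.2 : ℕ) = j then 1 else 0

/-- All terms of a tower relation at $t$ share their factors away from $t$; this isolates the one
factor to which the Pascal rule applies. -/
theorem phiCoef_eq_mul_erase [DecidableEq (Idx N)] {μ μ' : Idx N → ℤ} {q q' : XiVar N → ℤ} {t : Idx N}
    (h : ∀ t' ≠ t, μ' t' + prevExp q' t'.1 t'.2 = μ t' + prevExp q t'.1 t'.2 ∧
      xExp q' t'.1 t'.2 = xExp q t'.1 t'.2 ∧ yExp q' t'.1 t'.2 = yExp q t'.1 t'.2 ∧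
      zExp q' t'.1 t'.2 = zExp q t'.1 t'.2) :
    phiCoef K μ' q' = phiCoefAt K μ' q' t * ∏ t' ∈ Finset.univ.erase t, phiCoefAt K μ q t' := by
  rw [phiCoef, ← Finset.mul_prod_erase _ _ (Finset.mem_univ t)]
  congr 1
  refine Finset.prod_congr rfl fun t' ht' => ?_
  obtain ⟨h1, h2, h3, h4⟩ := h t' (Finset.ne_of_mem_erase ht')
  rw [phiCoefAt, phiCoefAt, h1, h2, h3, h4]

theorem spot_sum (s s' : Side) {j n : ℕ} (k : ℕ) (h : s' = s → j < k) :
    ∑ i ∈ Finset.range k, (spot s j n s' i : ℤ) = if s' = s then (n : ℤ) else 0 := by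
  by_cases hs : s' = s
  · simp [spot, hs, h hs]
  · simp [spot, hs]

theorem idx_ne_iff (t t' : Idx N) : t' ≠ t ↔ ¬ (t'.1 = t.1 ∧ (t'.2 : ℕ) = t.2) := by
  rw [not_iff_not]
  constructor
  · rintro rfl; simp
  · obtain ⟨s, i⟩ := t
    obtain ⟨s', i'⟩ := t'
    rintro ⟨rfl, h⟩
    simp [Fin.ext_iff] at h ⊢
    exact h

/-- Removing one $x_j$ lowers only $p_{-1}$ on its own side. The following two lemmas treat $y_j$,
which lowers $p_{-1}$ on the other side, and $z_j$, which lowers the entry used at position $j+1$.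
The unit vectors in `IsTower` compensate exactly these drops. -/
theorem prevExp_xVec {s : Side} {j : ℕ} (h : j < N s) (s' : Side) (j' : ℕ) :
    prevExp (castExp (expVec N (spot s j 1) 0 0)) s' j' = if s' = s ∧ j' = 0 then 1 else 0 := by
  unfold prevExp
  by_cases hj : j' = 0
  · rw [if_pos hj, Finset.sum_congr rfl (g := fun i => (spot s j 1 s' i : ℤ)),
      spot_sum _ _ _ (by rintro rfl; exact h)]
    · simp [yExp_expVec, hj]
    · intro i hi; simp [xExp_expVec, Finset.mem_range.1 hi]
  · simp [hj, zExp_expVec]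

theorem prevExp_yVec {s : Side} {j : ℕ} (h : j < N s) (ho : 0 < N s.other) (s' : Side) (j' : ℕ) :
    prevExp (castExp (expVec N 0 (spot s j 1) 0)) s' j' =
      if s' = s.other ∧ j' = 0 then 1 else 0 := by
  unfold prevExp
  by_cases hj : j' = 0
  · rw [if_pos hj, Finset.sum_congr (s₁ := .range (N s'.other)) rfl
      (g := fun i => (spot s j 1 s'.other i : ℤ)), spot_sum _ _ _ (by rintro rfl; exact h)]
    · have : s'.other = s ↔ s' = s.other := by cases s <;> cases s' <;> simp [Side.other]
      simp [xExp_expVec, hj, this]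
    · intro i hi
      rw [yExp_expVec]
      by_cases hs : s'.other = s
      · rw [if_pos ⟨Finset.mem_range.1 hi, by rwa [hs]⟩]
      · simp [spot, hs]
  · simp [hj, zExp_expVec]

theorem prevExp_zVec {s : Side} {j : ℕ} (h : j < N s - 1) (s' : Side) (j' : ℕ) :
    prevExp (castExp (expVec N 0 0 (spot s j 1))) s' j' =
      if s' = s ∧ j' = j + 1 then 1 else 0 := by
  unfold prevExp
  by_cases hj : j' = 0
  · simp [hj, xExp_expVec, yExp_expVec]
  · obtain ⟨i, rfl⟩ := Nat.exists_eq_succ_of_ne_zero hj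
    simp only [Nat.succ_ne_zero, if_false, zExp_expVec, spot, Nat.succ_eq_add_one,
      Nat.add_sub_cancel, Nat.add_right_cancel_iff]
    split_ifs <;> simp_all

/-- The linear relations satisfied by the monomials `w^μ`, where `w_j = u_{j+1} / u_j`. -/
def IsTower {K : Type*} [Field K] (F : (Idx N → ℤ) → MvPowerSeries (XiVar N) K) : Prop :=
  ∀ (μ : Idx N → ℤ) (t : Idx N), F (μ - unitAt N t.1 t.2) = F μ
    + xS N K t.1 t.2 * F (μ + unitAt N t.1 0)
    + yS N K t.1 t.2 * F (μ + unitAt N t.1.other 0)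
    - zS N K t.1 t.2 * F (μ + unitAt N t.1 (t.2 + 1))

/-- The series `Φ(ξ; μ, μ̃)` with the parameters indexed by positions. -/
noncomputable def phiSeries (μ : Idx N → ℤ) : MvPowerSeries (XiVar N) K :=
  Phi K fun s j => if h : j < N s then μ ⟨s, ⟨j, h⟩⟩ else 0

theorem coeff_monomial_mul_phiSeries (v : XiVar N →₀ ℕ) (μ : Idx N → ℤ) (q : XiVar N →₀ ℕ) :
    coeff q (monomial v 1 * phiSeries K μ) = phiCoef K μ (castExp q - castExp v) := by
  rw [phiSeries, coeff_monomial_mul_Phi]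
  simp

theorem coeff_phiSeries (μ : Idx N → ℤ) (q : XiVar N →₀ ℕ) :
    coeff q (phiSeries K μ) = phiCoef K μ (castExp q) := by
  rw [phiSeries, coeff_Phi]
  simp

theorem isTower_phiSeries [CharZero K] : IsTower (phiSeries K (N := N)) := by
  classical
  intro μ t
  ext q
  have hx : coeff q (xS N K t.1 t.2 * phiSeries K (μ + unitAt N t.1 0)) =
      negQuad K (μ t + prevExp (castExp q) t.1 t.2) (xExp (castExp q) t.1 t.2 - 1)
        (yExp (castExp q) t.1 t.2) (zExp (castExp q) t.1 t.2) *
      ∏ t' ∈ Finset.univ.erase t, phiCoefAt K μ (castExp q) t' := by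
    rw [← pow_one (xS N K t.1 t.2), xS_pow K t.2.isLt, coeff_monomial_mul_phiSeries,
      phiCoef_eq_mul_erase K (μ := μ) (q := castExp q) (t := t)]
    · simp [phiCoefAt, xExp_sub, yExp_sub, zExp_sub, prevExp_sub, prevExp_xVec, xExp_expVec,
        yExp_expVec, zExp_expVec, unitAt, spot]
    · intro t' ht'
      rw [idx_ne_iff] at ht'
      simp [xExp_sub, yExp_sub, zExp_sub, prevExp_sub, prevExp_xVec, xExp_expVec,
        yExp_expVec, zExp_expVec, unitAt, spot, ht']
  have hy : coeff q (yS N K t.1 t.2 * phiSeries K (μ + unitAt N t.1.other 0)) =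
      negQuad K (μ t + prevExp (castExp q) t.1 t.2) (xExp (castExp q) t.1 t.2)
        (yExp (castExp q) t.1 t.2 - 1) (zExp (castExp q) t.1 t.2) *
      ∏ t' ∈ Finset.univ.erase t, phiCoefAt K μ (castExp q) t' := by
    by_cases ho : 0 < N t.1.other
    · rw [← pow_one (yS N K t.1 t.2), yS_pow K ⟨t.2.isLt, ho⟩, coeff_monomial_mul_phiSeries,
        phiCoef_eq_mul_erase K (μ := μ) (q := castExp q) (t := t)]
      · simp [phiCoefAt, xExp_sub, yExp_sub, zExp_sub, prevExp_sub, prevExp_yVec, xExp_expVec,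
          yExp_expVec, zExp_expVec, unitAt, spot, ho]
      · intro t' ht'
        rw [idx_ne_iff] at ht'
        simp [xExp_sub, yExp_sub, zExp_sub, prevExp_sub, prevExp_yVec, xExp_expVec,
          yExp_expVec, zExp_expVec, unitAt, spot, ht', ho]
    -- With the other side empty there is no $y$: the series is $0$, and the coefficient vanishes as
    -- well because its $y$-exponent is $-1$.
    · rw [negQuad_of_neg (.inr (.inl _))]
      · simp [yS, ho]
      · simp [yExp, ho]
  have hz : coeff q (zS N K t.1 t.2 * phiSeries K (μ + unitAt N t.1 (t.2 + 1))) =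
      negQuad K (μ t + prevExp (castExp q) t.1 t.2) (xExp (castExp q) t.1 t.2)
        (yExp (castExp q) t.1 t.2) (zExp (castExp q) t.1 t.2 - 1) *
      ∏ t' ∈ Finset.univ.erase t, phiCoefAt K μ (castExp q) t' := by
    by_cases ho : (t.2 : ℕ) < N t.1 - 1
    · rw [← pow_one (zS N K t.1 t.2), zS_pow K ho, coeff_monomial_mul_phiSeries,
        phiCoef_eq_mul_erase K (μ := μ) (q := castExp q) (t := t)]
      · simp [phiCoefAt, xExp_sub, yExp_sub, zExp_sub, prevExp_sub, prevExp_zVec, xExp_expVec,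
          yExp_expVec, zExp_expVec, unitAt, spot, ho]
      · intro t' ht'
        rw [idx_ne_iff] at ht'
        simp [xExp_sub, yExp_sub, zExp_sub, prevExp_sub, prevExp_zVec, xExp_expVec,
          yExp_expVec, zExp_expVec, unitAt, spot, ht', ho]
    -- The last position has no $z$; its exponent is read as $0$, hence $-1$ after the shift.
    · rw [negQuad_of_neg (.inr (.inr _))]
      · simp [zS, ho]
      · simp [zExp, ho]
  rw [map_sub, map_add, map_add, hx, hy, hz, coeff_phiSeries, coeff_phiSeries,
    phiCoef_eq_mul_erase K (μ := μ) (q := castExp q) (t := t),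
    phiCoef_eq_mul_erase K (μ := μ) (μ' := μ) (q := castExp q) (t := t)]
  · have : phiCoefAt K (μ - unitAt N t.1 t.2) (castExp q) t =
        negQuad K (μ t + prevExp (castExp q) t.1 t.2 - 1) (xExp (castExp q) t.1 t.2)
        (yExp (castExp q) t.1 t.2) (zExp (castExp q) t.1 t.2) := by
      rw [phiCoefAt]
      congr 1
      simp [unitAt]
      ring
    rw [this, negQuad_pred, phiCoefAt]
    ring
  · intros; simp
  · intro t' ht'
    rw [idx_ne_iff] at ht'
    simp [unitAt, ht']

variable {K}

theorem constantCoeff_xS (s : Side) (j : ℕ) : constantCoeff (xS N K s j) = 0 := by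
  unfold xS; split <;> simp

theorem constantCoeff_yS (s : Side) (j : ℕ) : constantCoeff (yS N K s j) = 0 := by
  unfold yS; split <;> simp

theorem constantCoeff_zS (s : Side) (j : ℕ) : constantCoeff (zS N K s j) = 0 := by
  unfold zS; split <;> simp

namespace IsTower

variable {F G : (Idx N → ℤ) → MvPowerSeries (XiVar N) K}

theorem sub (hF : IsTower F) (hG : IsTower G) : IsTower (F - G) := by
  intro μ t
  simp only [Pi.sub_apply, hF μ t, hG μ t]
  ring

theorem mul_const (hF : IsTower F) (c : MvPowerSeries (XiVar N) K) :
    IsTower fun μ => F μ * c := by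
  intro μ t
  simp only [hF μ t]
  ring

theorem shift (hF : IsTower F) (lam : Idx N → ℤ) : IsTower fun μ => F (μ + lam) := by
  intro μ t
  have := hF (μ + lam) t
  simp only [sub_add_eq_add_sub, add_right_comm _ _ lam] at this ⊢
  exact this

/-- If all values have order at least $n$, the relation makes $F(\mu-e_t)-F(\mu)$ of order at least
$n+1$, since $x,y,z$ have no constant term. The unit vectors generate the lattice, so every $F(\mu)$
agrees with $F(0)=0$ to order $n+1$. -/
theorem eq_zero (hF : IsTower F) (h0 : F 0 = 0) (μ : Idx N → ℤ) : F μ = 0 := by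
  suffices h : ∀ n μ, F μ ∈ orderIdeal (XiVar N) K n from
    eq_zero_of_forall_mem_orderIdeal fun n => h n μ
  intro n
  induction n with
  | zero => exact fun μ => mem_orderIdeal_zero _
  | succ n ih =>
    -- The periods of $F$ modulo order $n+1$ form a subgroup.
    let H : AddSubgroup (Idx N → ℤ) :=
      { carrier := {δ | ∀ μ, F (μ + δ) - F μ ∈ orderIdeal (XiVar N) K (n + 1)}
        zero_mem' := fun μ => by simp
        add_mem' := fun {a b} ha hb μ => by
          have := add_mem (hb (μ + a)) (ha μ)
          rwa [sub_add_sub_cancel, add_assoc] at this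
        neg_mem' := fun {a} ha μ => by
          have := neg_mem (ha (μ + -a))
          rwa [neg_sub, neg_add_cancel_right] at this }
    have hunit (t : Idx N) : unitAt N t.1 t.2 ∈ H := by
      rw [← neg_mem_iff]
      intro μ
      have e : F (μ + -unitAt N t.1 t.2) - F μ = xS N K t.1 t.2 * F (μ + unitAt N t.1 0)
          + yS N K t.1 t.2 * F (μ + unitAt N t.1.other 0)
          - zS N K t.1 t.2 * F (μ + unitAt N t.1 (t.2 + 1)) := by
        rw [← sub_eq_add_neg, hF]; ring
      rw [e]
      exact sub_mem (add_mem (mul_mem_orderIdeal_succ (constantCoeff_xS _ _) (ih _))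
        (mul_mem_orderIdeal_succ (constantCoeff_yS _ _) (ih _)))
        (mul_mem_orderIdeal_succ (constantCoeff_zS _ _) (ih _))
    intro μ
    have hμ : μ ∈ H := by
      have : μ = ∑ t, μ t • unitAt N t.1 t.2 := by
        ext t'
        rw [Finset.sum_apply, Finset.sum_eq_single t']
        · simp [unitAt]
        · intro t _ ht
          rw [ne_comm, idx_ne_iff] at ht
          simp [unitAt, ht]
        · simp
      rw [this]
      exact sum_mem fun t _ => zsmul_mem (hunit t) _
    simpa [h0] using hμ 0

theorem ext (hF : IsTower F) (hG : IsTower G) (h0 : F 0 = G 0) (μ : Idx N → ℤ) : F μ = G μ :=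
  sub_eq_zero.1 ((hF.sub hG).eq_zero (by simp [h0]) μ)

end IsTower

/-! ### Multiplicativity: $\Phi(\mu)/\Phi(0)$ as the monomial $w^\mu$ -/

section Monomials

variable [CharZero K]

/-- As functions of $\mu$ both sides satisfy the tower relations, and at $\mu=0$ they agree by
commutativity. -/
theorem phiSeries_add_mul (μ lam : Idx N → ℤ) :
    phiSeries K (μ + lam) * phiSeries K 0 = phiSeries K μ * phiSeries K lam :=
  (((isTower_phiSeries K).shift lam).mul_const _).ext ((isTower_phiSeries K).mul_const _)
    (by simp [mul_comm]) μ

theorem constantCoeff_phiSeries (μ : Idx N → ℤ) : constantCoeff (phiSeries K μ) = 1 := by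
  rw [← coeff_zero_eq_constantCoeff_apply, coeff_phiSeries, phiCoef]
  refine Finset.prod_eq_one fun t _ => ?_
  have := negQuad_natCast (K := K) (μ t + prevExp (castExp (0 : XiVar N →₀ ℕ)) t.1 t.2) 0 0 0
  simpa [phiCoefAt, xExp_castExp, yExp_castExp, zExp_castExp, mExp, nExp, pExp] using this

theorem isUnit_phiSeries (μ : Idx N → ℤ) : IsUnit (phiSeries K μ) := by
  rw [isUnit_iff_constantCoeff, constantCoeff_phiSeries]
  exact isUnit_one

variable (N K) in
/-- The monomials `w^μ`, where `w_j = u_{j+1} / u_j`. -/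
noncomputable def towerUnit : (Idx N → ℤ) →+ Additive (MvPowerSeries (XiVar N) K)ˣ :=
  AddMonoidHom.mk' (fun μ => Additive.ofMul
    ((isUnit_phiSeries μ).unit * ((isUnit_phiSeries (K := K) (N := N) 0).unit)⁻¹)) <| by
      intro μ lam
      rw [← ofMul_mul]
      congr 1
      rw [mul_mul_mul_comm, ← mul_assoc, eq_mul_inv_iff_mul_eq, inv_mul_cancel_right]
      rw [eq_mul_inv_iff_mul_eq]
      ext1
      exact phiSeries_add_mul μ lam

/-- The monomials `w^μ` as power series. -/
noncomputable def towerSeries (μ : Idx N → ℤ) : MvPowerSeries (XiVar N) K :=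
  ((towerUnit N K μ).toMul : (MvPowerSeries (XiVar N) K)ˣ)

theorem towerSeries_def (μ : Idx N → ℤ) : towerSeries μ =
    phiSeries K μ * (((isUnit_phiSeries (K := K) (N := N) 0).unit⁻¹ :
      (MvPowerSeries (XiVar N) K)ˣ) : MvPowerSeries (XiVar N) K) :=
  rfl

theorem phiSeries_eq (μ : Idx N → ℤ) : phiSeries K μ = towerSeries μ * phiSeries K 0 := by
  rw [towerSeries_def, mul_assoc, IsUnit.val_inv_mul, mul_one]

theorem isTower_towerSeries : IsTower (towerSeries (K := K) (N := N)) :=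
  (isTower_phiSeries K (N := N)).mul_const
    (((isUnit_phiSeries (K := K) (N := N) 0).unit⁻¹ : (MvPowerSeries (XiVar N) K)ˣ) :
      MvPowerSeries (XiVar N) K)

theorem towerSeries_add (μ lam : Idx N → ℤ) :
    towerSeries (K := K) (μ + lam) = towerSeries μ * towerSeries lam := by
  rw [towerSeries, map_add, toMul_add, Units.val_mul]
  rfl

theorem towerSeries_zero : towerSeries (K := K) (0 : Idx N → ℤ) = 1 := by
  simp [towerSeries]

end Monomials

end Tower

/-! ### The identity $E_0=1$ -/

section Normalisation

variable {N : Side → ℕ} (K : Type*) [Field K]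

/-- Division-free form of a telescoping product: formally $f_j/b_j$ is $A_{j+1}/A_j$ for $j<i$, is
$-w/A_i$ at $j=i$, and is $1$ afterwards. -/
theorem prod_range_telescope {R : Type*} [CommRing R] (A f b : ℕ → R) (w : R) {i n : ℕ} (hi : i < n)
    (hlt : ∀ j < i, A j * f j = A (j + 1) * b j) (heq : A i * f i = -(w * b i))
    (hgt : ∀ j, i < j → f j = b j) :
    A 0 * ∏ j ∈ Finset.range n, f j = -(w * ∏ j ∈ Finset.range n, b j) := by
  have key : ∀ l ≤ i, A 0 * ∏ j ∈ Finset.range l, f j = A l * ∏ j ∈ Finset.range l, b j := by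
    intro l hl
    induction l with
    | zero => simp
    | succ l ih =>
      rw [Finset.prod_range_succ, Finset.prod_range_succ, ← mul_assoc, ih (by omega)]
      linear_combination (∏ j ∈ Finset.range l, b j) * hlt l hl
  obtain ⟨k, rfl⟩ := Nat.exists_eq_add_of_le (Nat.succ_le_of_lt hi)
  rw [Finset.prod_range_add, Finset.prod_range_add, Finset.prod_range_succ, Finset.prod_range_succ,
    Finset.prod_congr rfl fun j _ => hgt (i.succ + j) (by omega)]
  linear_combination (∏ x ∈ Finset.range k, b (i.succ + x)) *
    (f i * key i le_rfl + (∏ j ∈ Finset.range i, b j) * heq)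

theorem stepF_of_lt {i j : ℤ} (h : j < i) : stepF i j = 1 := if_pos h

theorem stepF_of_le {i j : ℤ} (h : i ≤ j) : stepF i j = 0 := if_neg (not_lt.2 h)

theorem delta_of_ne {i j : ℤ} (h : i ≠ j) : delta i j = 0 := if_neg h

theorem delta_self (i : ℤ) : delta i i = 1 := if_pos rfl

/-- The factor on side `s` in the coefficient of `ξ^{𝔣_i} Φ(ξ; ν^i)`. -/
noncomputable def fCoef (q : XiVar N → ℤ) (s : Side) (i : ℤ) : K :=
  ∏ j ∈ Finset.range (N s), negQuad K (prevExp q s j + stepF i ((j : ℤ) - 1))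
    (xExp q s j - delta i j) (yExp q s j) (zExp q s j - stepF i j)

/-- The factor on side `s` in the coefficient of `ξ^{𝔤_i} Φ(ξ; ν^i)`. -/
noncomputable def gCoef (q : XiVar N → ℤ) (s : Side) (i : ℤ) : K :=
  ∏ j ∈ Finset.range (N s), negQuad K (prevExp q s j + stepF i ((j : ℤ) - 1))
    (xExp q s j) (yExp q s j - delta i j) (zExp q s j - stepF i j)

theorem prevExp_succ (q : XiVar N → ℤ) (s : Side) (j : ℕ) :
    prevExp q s (j + 1) = zExp q s j := by
  simp [prevExp]

theorem fCoef_neg_one (q : XiVar N → ℤ) (s : Side) : fCoef K q s (-1) =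
    ∏ j ∈ Finset.range (N s),
      negQuad K (prevExp q s j) (xExp q s j) (yExp q s j) (zExp q s j) := by
  refine Finset.prod_congr rfl fun j _ => ?_
  rw [stepF_of_le (by omega), delta_of_ne (by omega), stepF_of_le (by omega)]
  simp

/-- Telescoping with $A_j=p_{j-1}$. For $j<i$ the $Z$-rule trades the factor $p_{j-1}$ for $p_j$, at
$j=i$ the $X$-rule ends the chain with $-m_i$, and later factors are those of index $-1$. The
version for $\mathfrak g_i$ ends with the $Y$-rule and $-n_i$. -/
theorem prevExp_mul_fCoef [CharZero K] (q : XiVar N → ℤ) {s : Side} {i : ℕ} (hi : i < N s) :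
    (prevExp q s 0 : K) * fCoef K q s i = -(xExp q s i * fCoef K q s (-1)) := by
  rw [fCoef_neg_one]
  refine prod_range_telescope (fun j => (prevExp q s j : K)) _ _ _ hi ?_ ?_ ?_
  · intro j hj
    rw [stepF_of_lt (by omega), delta_of_ne (by omega), stepF_of_lt (by omega), prevExp_succ,
      mul_negQuad_z]
    simp
  · rw [stepF_of_lt (by omega), delta_self, stepF_of_le le_rfl, mul_negQuad_x]
    simp
  · intro j hj
    rw [stepF_of_le (by omega), delta_of_ne (by omega), stepF_of_le (by omega)]
    simp

theorem prevExp_mul_gCoef [CharZero K] (q : XiVar N → ℤ) {s : Side} {i : ℕ} (hi : i < N s) :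
    (prevExp q s 0 : K) * gCoef K q s i = -(yExp q s i * fCoef K q s (-1)) := by
  rw [fCoef_neg_one]
  refine prod_range_telescope (fun j => (prevExp q s j : K)) _ _ _ hi ?_ ?_ ?_
  · intro j hj
    rw [stepF_of_lt (by omega), delta_of_ne (by omega), stepF_of_lt (by omega), prevExp_succ,
      mul_negQuad_z]
    simp
  · rw [stepF_of_lt (by omega), delta_self, stepF_of_le le_rfl, mul_negQuad_y]
    simp
  · intro j hj
    rw [stepF_of_le (by omega), delta_of_ne (by omega), stepF_of_le (by omega)]
    simp

/-- Covers the case $p_{-1}=0$, in which `prevExp_mul_fCoef` does not determine the factor. -/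
theorem fCoef_eq_zero {q : XiVar N → ℤ} {s : Side} {i : ℕ} (hi : i < N s) (h : xExp q s i ≤ 0) :
    fCoef K q s i = 0 :=
  Finset.prod_eq_zero (Finset.mem_range.2 hi) (negQuad_of_neg (.inl (by simp [delta]; omega)))

theorem gCoef_eq_zero {q : XiVar N → ℤ} {s : Side} {i : ℕ} (hi : i < N s) (h : yExp q s i ≤ 0) :
    gCoef K q s i = 0 :=
  Finset.prod_eq_zero (Finset.mem_range.2 hi)
    (negQuad_of_neg (.inr (.inl (by simp [delta]; omega))))

/-- A cascade: where $p_{j-1}=0$, a nonzero coefficient with $A=0$ forces $m_j=n_j=p_j=0$, and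
$p_j=0$ is the hypothesis at the next position. -/
theorem exps_eq_zero {q : XiVar N → ℤ} {s : Side} (h0 : prevExp q s 0 = 0)
    (h : fCoef K q s (-1) ≠ 0) {j : ℕ} (hj : j < N s) :
    xExp q s j = 0 ∧ yExp q s j = 0 ∧ zExp q s j = 0 := by
  rw [fCoef_neg_one, Finset.prod_ne_zero_iff] at h
  have step (j : ℕ) (hj : j < N s) (hp : prevExp q s j = 0) :
      xExp q s j = 0 ∧ yExp q s j = 0 ∧ zExp q s j = 0 := by
    have := h j (Finset.mem_range.2 hj)
    rw [hp] at this
    exact negQuad_zero_zero _ _ _ this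
  have hprev : ∀ j, j < N s → prevExp q s j = 0 := by
    intro j
    induction j with
    | zero => exact fun _ => h0
    | succ j ih =>
      intro hj
      rw [prevExp_succ]
      exact (step j (by omega) (ih (by omega))).2.2
  exact step j hj (hprev j hj)

/-- The bracket in the coefficient of the expansion of `1` at `q`, for `q ≥ 0`. -/
theorem coef_normalisation [CharZero K] (q : XiVar N → ℤ) (hq : ∀ v, 0 ≤ q v) :
    (fCoef K q .plain (-1) + ∑ i ∈ Finset.range (N .plain), fCoef K q .plain i) *
      (fCoef K q .tilde (-1) + ∑ i ∈ Finset.range (N .tilde), fCoef K q .tilde i) -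
    (∑ i ∈ Finset.range (N .plain), gCoef K q .plain i) *
      (∑ i ∈ Finset.range (N .tilde), gCoef K q .tilde i) =
    fCoef K q .plain (-1) * fCoef K q .tilde (-1) *
      if prevExp q .plain 0 = 0 ∧ prevExp q .tilde 0 = 0 then 1 else 0 := by
  have hx (s j) : 0 ≤ xExp q s j := by unfold xExp; split <;> simp [hq]
  have hy (s j) : 0 ≤ yExp q s j := by unfold yExp; split <;> simp [hq]
  have hA (s) : prevExp q s 0 = ∑ i ∈ Finset.range (N s), xExp q s i +
    ∑ i ∈ Finset.range (N s.other), yExp q s.other i := by simp [prevExp]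
  have hF (s) : (prevExp q s 0 : K) * ∑ i ∈ Finset.range (N s), fCoef K q s i =
      -((∑ i ∈ Finset.range (N s), xExp q s i : ℤ) * fCoef K q s (-1)) := by
    rw [Finset.mul_sum, Int.cast_sum, Finset.sum_mul, ← Finset.sum_neg_distrib]
    exact Finset.sum_congr rfl fun i hi => prevExp_mul_fCoef K q (Finset.mem_range.1 hi)
  have hG (s) : (prevExp q s 0 : K) * ∑ i ∈ Finset.range (N s), gCoef K q s i =
      -((∑ i ∈ Finset.range (N s), yExp q s i : ℤ) * fCoef K q s (-1)) := by
    rw [Finset.mul_sum, Int.cast_sum, Finset.sum_mul, ← Finset.sum_neg_distrib]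
    exact Finset.sum_congr rfl fun i hi => prevExp_mul_gCoef K q (Finset.mem_range.1 hi)
  -- If $p_{-1}=|m|+|\tilde n|=0$, nonnegativity makes both sums of exponents vanish termwise.
  -- Moreover $|n|$ times the factor of index $-1$ is zero, because a nonzero factor forces all
  -- exponents on this side to vanish.
  have hzero (s) (h0 : prevExp q s 0 = 0) :
      ∑ i ∈ Finset.range (N s), fCoef K q s i = 0 ∧
      ∑ i ∈ Finset.range (N s.other), gCoef K q s.other i = 0 ∧
      (∑ i ∈ Finset.range (N s.other), yExp q s.other i) = 0 ∧
      ((∑ i ∈ Finset.range (N s), yExp q s i : ℤ) : K) * fCoef K q s (-1) = 0 := by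
    have h1 := Finset.sum_nonneg fun i (_ : i ∈ Finset.range (N s)) => hx s i
    have h2 := Finset.sum_nonneg fun i (_ : i ∈ Finset.range (N s.other)) => hy s.other i
    have hA' := hA s
    have h1' : ∑ i ∈ Finset.range (N s), xExp q s i = 0 := by omega
    have h2' : ∑ i ∈ Finset.range (N s.other), yExp q s.other i = 0 := by omega
    refine ⟨Finset.sum_eq_zero fun i hi => ?_, Finset.sum_eq_zero fun i hi => ?_, h2', ?_⟩
    · exact fCoef_eq_zero K (Finset.mem_range.1 hi)
        ((Finset.sum_eq_zero_iff_of_nonneg fun i _ => hx s i).1 h1' i hi).le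
    · exact gCoef_eq_zero K (Finset.mem_range.1 hi)
        ((Finset.sum_eq_zero_iff_of_nonneg fun i _ => hy s.other i).1 h2' i hi).le
    · by_cases hP : fCoef K q s (-1) = 0
      · rw [hP, mul_zero]
      · rw [Finset.sum_eq_zero fun i hi => (exps_eq_zero K h0 hP (Finset.mem_range.1 hi)).2.1]
        simp
  have hAp : (prevExp q .plain 0 : K) = (∑ i ∈ Finset.range (N .plain), xExp q .plain i : ℤ) +
    (∑ i ∈ Finset.range (N .tilde), yExp q .tilde i : ℤ) := by
    rw [← Int.cast_add, hA .plain]; rfl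
  have hAt : (prevExp q .tilde 0 : K) = (∑ i ∈ Finset.range (N .tilde), xExp q .tilde i : ℤ) +
    (∑ i ∈ Finset.range (N .plain), yExp q .plain i : ℤ) := by
    rw [← Int.cast_add, hA .tilde]; rfl
  have hFp := hF .plain
  have hFt := hF .tilde
  have hGp := hG .plain
  have hGt := hG .tilde
  have hzp := hzero .plain
  have hzt := hzero .tilde
  simp only [Side.other] at hzp hzt
  -- The relations determine the sums only after multiplication by $p_{-1}$ and $\tilde p_{-1}$, so
  -- their vanishing is treated separately.
  by_cases h0 : prevExp q .plain 0 = 0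
  · obtain ⟨z1, z2, z3, z4⟩ := hzp h0
    by_cases h1 : prevExp q .tilde 0 = 0
    · obtain ⟨y1, y2, y3, y4⟩ := hzt h1
      simp [h0, h1, z1, z2, y1, y2]
    · have h1' : (prevExp q .tilde 0 : K) ≠ 0 := by exact_mod_cast h1
      simp only [h1, and_false, if_false, mul_zero, z1, z2, add_zero, sub_zero]
      refine (mul_eq_zero.1 ?_).resolve_left h1'
      linear_combination fCoef K q .plain (-1) * hFt + fCoef K q .tilde (-1) * z4 +
        fCoef K q .plain (-1) * fCoef K q .tilde (-1) * hAt
  · have h0' : (prevExp q .plain 0 : K) ≠ 0 := by exact_mod_cast h0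
    simp only [h0, false_and, if_false, mul_zero]
    refine (mul_eq_zero.1 ?_).resolve_left h0'
    by_cases h1 : prevExp q .tilde 0 = 0
    · obtain ⟨y1, y2, y3, y4⟩ := hzt h1
      simp only [y1, y2, zero_mul, sub_zero, add_zero]
      linear_combination fCoef K q .tilde (-1) * hFp + fCoef K q .plain (-1) * y4 +
        fCoef K q .plain (-1) * fCoef K q .tilde (-1) * hAp
    · have h1' : (prevExp q .tilde 0 : K) ≠ 0 := by exact_mod_cast h1
      refine (mul_eq_zero.1 ?_).resolve_left h1'
      set Ap : K := (prevExp q .plain 0 : K)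
      set At : K := (prevExp q .tilde 0 : K)
      set Pp := fCoef K q .plain (-1)
      set Pt := fCoef K q .tilde (-1)
      set Fp := ∑ i ∈ Finset.range (N .plain), fCoef K q .plain i
      set Ft := ∑ i ∈ Finset.range (N .tilde), fCoef K q .tilde i
      set Gp := ∑ i ∈ Finset.range (N .plain), gCoef K q .plain i
      set Gt := ∑ i ∈ Finset.range (N .tilde), gCoef K q .tilde i
      set Lp : K := ((∑ i ∈ Finset.range (N .plain), yExp q .plain i : ℤ) : K)
      set Lt : K := ((∑ i ∈ Finset.range (N .tilde), yExp q .tilde i : ℤ) : K)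
      -- Here $p_{-1}-|m|=|\tilde n|$ and $\tilde p_{-1}-|\tilde m|=|n|$. Multiplied by
      -- $p_{-1}\tilde p_{-1}$, the $\mathfrak f$-product and the $\mathfrak g$-product both become
      -- $|n||\tilde n|$ times the product of the factors of index $-1$, and cancel.
      have e1 : Ap * (Pp + Fp) = Lt * Pp := by linear_combination hFp + Pp * hAp
      have e2 : At * (Pt + Ft) = Lp * Pt := by linear_combination hFt + Pt * hAt
      linear_combination At * (Pt + Ft) * e1 + Lt * Pp * e2 - At * Gt * hGp + Lp * Pp * hGt

/-- The exponent vector of `ξ^{𝔣_i + 𝔣̃_ι}`, where `I = (i, ι)`. -/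
noncomputable def fVec (N : Side → ℕ) (I : Side → ℤ) : XiVar N →₀ ℕ :=
  expVec N (fun s j => delta (I s) j) 0 (fun s j => stepF (I s) j)

/-- The exponent vector of `ξ^{𝔤_i + 𝔤̃_ι}`, where `I = (i, ι)`. -/
noncomputable def gVec (N : Side → ℕ) (I : Side → ℤ) : XiVar N →₀ ℕ :=
  expVec N 0 (fun s j => delta (I s) j) (fun s j => stepF (I s) j)

/-- At the last position $z$ is read as $0$, but there $\sigma_{ij}=0$, so the convention $0^0=1$
applies. -/
theorem zS_pow_stepF {s : Side} {i : ℤ} (hi : i < N s) {j : ℕ} (hj : j < N s) :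
    zS N K s j ^ stepF i j = monomial (expVec N 0 0 (spot s j (stepF i j))) 1 := by
  by_cases h : j < N s - 1
  · exact zS_pow K h _
  · have h0 : expVec N 0 0 0 = 0 := by ext v; cases v <;> simp [expVec]
    have : stepF i j = 0 := by rw [stepF, if_neg (by omega)]
    have h1 : spot s j 0 = 0 := by ext; simp [spot]
    rw [this, h1, h0, pow_zero]
    rfl

theorem sum_spot_apply (s s' : Side) (n : ℕ) (f : ℕ → ℕ) (j : ℕ) :
    (∑ i ∈ Finset.range n, spot s i (f i)) s' j = if s' = s ∧ j < n then f j else 0 := by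
  simp only [Finset.sum_apply, spot]
  by_cases hs : s' = s <;> simp [hs]

theorem xiF_eq_monomial {s : Side} {i : ℤ} (hi : i < N s) :
    xiF N K s i = monomial (expVec N (fun s' j => if s' = s then delta i j else 0) 0
      (fun s' j => if s' = s then stepF i j else 0)) 1 := by
  rw [xiF, Finset.prod_congr rfl (g := fun j => monomial
    (expVec N (spot s j (delta i j)) 0 (spot s j (stepF i j))) (1 : K))]
  · rw [prod_monomial, Finset.prod_const_one, expVec_sum]
    congr 1
    congr 1
    ext v
    cases v with
    | x s' j => by_cases h : s' = s <;> simp [expVec, sum_spot_apply, h] ; subst h; simp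
    | y s' j => simp [expVec]
    | z s' j =>
      by_cases h : s' = s <;> simp [expVec, sum_spot_apply, h]
      subst h
      intro h
      omega
  · intro j hj
    rw [xS_pow K (Finset.mem_range.1 hj), zS_pow_stepF K hi (Finset.mem_range.1 hj),
      monomial_mul_monomial, expVec_add]
    simp

theorem xiG_eq_monomial {s : Side} {i : ℤ} (hi : i < N s) (ho : 0 < N s.other) :
    xiG N K s i = monomial (expVec N 0 (fun s' j => if s' = s then delta i j else 0)
      (fun s' j => if s' = s then stepF i j else 0)) 1 := by
  rw [xiG, Finset.prod_congr rfl (g := fun j => monomial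
    (expVec N 0 (spot s j (delta i j)) (spot s j (stepF i j))) (1 : K))]
  · rw [prod_monomial, Finset.prod_const_one, expVec_sum]
    congr 1
    congr 1
    ext v
    cases v with
    | x s' j => simp [expVec]
    | y s' j => by_cases h : s' = s <;> simp [expVec, sum_spot_apply, h] ; subst h; simp
    | z s' j =>
      by_cases h : s' = s <;> simp [expVec, sum_spot_apply, h]
      subst h
      intro h
      omega
  · intro j hj
    rw [yS_pow K ⟨Finset.mem_range.1 hj, ho⟩, zS_pow_stepF K hi (Finset.mem_range.1 hj),
      monomial_mul_monomial, expVec_add]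
    simp

theorem xiF_mul_xiF (I : Side → ℤ) (hI : ∀ s, I s < N s) :
    xiF N K .plain (I .plain) * xiF N K .tilde (I .tilde) = monomial (fVec N I) 1 := by
  rw [xiF_eq_monomial K (hI _), xiF_eq_monomial K (hI _), monomial_mul_monomial, expVec_add,
    mul_one, fVec]
  congr 2
  ext v
  rcases v with ⟨_ | _, _⟩ | ⟨_ | _, _⟩ | ⟨_ | _, _⟩ <;> simp [expVec]

theorem xiG_mul_xiG (I : Side → ℤ) (hI : ∀ s, I s < N s) (hN : ∀ s, 0 < N s) :
    xiG N K .plain (I .plain) * xiG N K .tilde (I .tilde) = monomial (gVec N I) 1 := by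
  rw [xiG_eq_monomial K (hI _) (hN _), xiG_eq_monomial K (hI _) (hN _), monomial_mul_monomial,
    expVec_add, mul_one, gVec]
  congr 2
  ext v
  rcases v with ⟨_ | _, _⟩ | ⟨_ | _, _⟩ | ⟨_ | _, _⟩ <;> simp [expVec]

theorem sum_delta {i : ℤ} {n : ℕ} (h : i < n) :
    ∑ j ∈ Finset.range n, (delta i j : ℤ) = stepF i (-1) := by
  by_cases h0 : -1 < i
  · obtain ⟨i, rfl⟩ := Int.eq_ofNat_of_zero_le (a := i) (by omega)
    have : i < n := by omega
    rw [stepF_of_lt h0]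
    simp [delta, this]
  · rw [stepF, if_neg h0]
    exact Finset.sum_eq_zero fun j _ => by rw [delta, if_neg (by omega)]; rfl

/-- The shift by $\xi^{\mathfrak f}$ lowers $p_{j-1}$ by $\sigma_{i,j-1}$, so of the parameter
$\nu^i_j=2\sigma_{i,j-1}$ one copy of $\sigma_{i,j-1}$ remains, as in `fCoef`. -/
theorem prevExp_fVec {I : Side → ℤ} (hI : ∀ s, I s < N s) {s : Side} {j : ℕ} (hj : j < N s) :
    prevExp (castExp (fVec N I)) s j = stepF (I s) ((j : ℤ) - 1) := by
  rcases j with _ | j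
  · rw [prevExp, if_pos rfl, Finset.sum_congr (s₁ := .range (N s)) rfl
      (g := fun j => (delta (I s) j : ℤ)),
      sum_delta (hI s)]
    · simp [fVec, yExp_expVec]
    · intro i hi
      simp [fVec, xExp_expVec, Finset.mem_range.1 hi]
  · rw [prevExp_succ, fVec, zExp_expVec, if_pos (by omega)]
    simp

/-- For $\mathfrak g$ the drop of $p_{-1}$ comes from the $y$ of the other side. Since both indices
are nonnegative it equals $1$ on either side, which is what lets the coefficient factor over the
sides. -/
theorem prevExp_gVec {I : Side → ℤ} (hI : ∀ s, I s < N s) (hI0 : ∀ s, 0 ≤ I s) {s : Side} {j : ℕ}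
    (hj : j < N s) :
    prevExp (castExp (gVec N I)) s j = stepF (I s) ((j : ℤ) - 1) := by
  rcases j with _ | j
  · rw [prevExp, if_pos rfl, Finset.sum_congr (s₁ := .range (N s.other)) rfl
      (g := fun j => (delta (I s.other) j : ℤ)), sum_delta (hI _)]
    · have h1 := hI0 s
      have h2 := hI0 s.other
      simp [gVec, xExp_expVec, stepF, show -1 < I s by omega, show -1 < I s.other by omega]
    · intro i hi
      have := Finset.mem_range.1 hi
      simp [gVec, yExp_expVec, this, Side.other_other, show 0 < N s by omega]
  · rw [prevExp_succ, gVec, zExp_expVec, if_pos (by omega)]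
    simp

theorem ite_stepF {s : Side} {i : ℤ} (hi : i < N s) {j : ℕ} (hj : j < N s) :
    (if j < N s - 1 then (stepF i j : ℤ) else 0) = stepF i j := by
  split_ifs with h
  · rfl
  · rw [stepF, if_neg (by omega)]; rfl

theorem coeff_fVec_mul (I : Side → ℤ) (hI : ∀ s, I s < N s) (q : XiVar N →₀ ℕ) :
    coeff q (monomial (fVec N I) 1 * Phi K fun s j => nuPar (I s) j) =
      fCoef K (castExp q) .plain (I .plain) * fCoef K (castExp q) .tilde (I .tilde) := by
  rw [coeff_monomial_mul_Phi, phiCoef, ← Finset.univ_sigma_univ, Finset.prod_sigma,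
    Side.prod_univ]
  have key (s : Side) : ∏ i : Fin (N s), phiCoefAt K (fun t => nuPar (I t.1) t.2)
      (castExp q - castExp (fVec N I)) ⟨s, i⟩ = fCoef K (castExp q) s (I s) := by
    rw [fCoef, ← Fin.prod_univ_eq_prod_range (fun j => negQuad K _ _ _ _)]
    refine Finset.prod_congr rfl fun i _ => ?_
    rw [phiCoefAt, xExp_sub, yExp_sub, zExp_sub, prevExp_sub, prevExp_fVec hI i.2, fVec,
      xExp_expVec, yExp_expVec, zExp_expVec, ite_stepF (hI s) i.2, if_pos i.2]
    congr 1
    · simp only [nuPar]; ring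
    · simp
  rw [key, key]

theorem coeff_gVec_mul (I : Side → ℤ) (hI : ∀ s, I s < N s) (hI0 : ∀ s, 0 ≤ I s)
    (q : XiVar N →₀ ℕ) :
    coeff q (monomial (gVec N I) 1 * Phi K fun s j => nuPar (I s) j) =
      gCoef K (castExp q) .plain (I .plain) * gCoef K (castExp q) .tilde (I .tilde) := by
  have hN (s) : 0 < N s := by have := hI s; have := hI0 s; omega
  rw [coeff_monomial_mul_Phi, phiCoef, ← Finset.univ_sigma_univ, Finset.prod_sigma,
    Side.prod_univ]
  have key (s : Side) : ∏ i : Fin (N s), phiCoefAt K (fun t => nuPar (I t.1) t.2)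
      (castExp q - castExp (gVec N I)) ⟨s, i⟩ = gCoef K (castExp q) s (I s) := by
    rw [gCoef, ← Fin.prod_univ_eq_prod_range (fun j => negQuad K _ _ _ _)]
    refine Finset.prod_congr rfl fun i _ => ?_
    rw [phiCoefAt, xExp_sub, yExp_sub, zExp_sub, prevExp_sub, prevExp_gVec hI hI0 i.2, gVec,
      xExp_expVec, yExp_expVec, zExp_expVec, ite_stepF (hI s) i.2,
      if_pos (show (i : ℕ) < N s ∧ 0 < N s.other from ⟨i.2, hN _⟩)]
    congr 1
    · simp only [nuPar]; ring
    · simp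
  rw [key, key]

theorem sum_Icc_zero {M : Type*} [AddCommMonoid M] (f : ℤ → M) (n : ℕ) :
    ∑ i ∈ Finset.Icc (0 : ℤ) ((n : ℤ) - 1), f i = ∑ i ∈ Finset.range n, f i := by
  refine (Finset.sum_bij (fun (i : ℕ) _ => (i : ℤ)) ?_ ?_ ?_ ?_).symm
  · intro i hi
    have := Finset.mem_range.1 hi
    rw [Finset.mem_Icc]; omega
  · intro i _ j _ h; exact_mod_cast h
  · intro i hi
    rw [Finset.mem_Icc] at hi
    exact ⟨i.toNat, by rw [Finset.mem_range]; omega, by omega⟩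
  · intros; rfl

theorem sum_Icc_neg_one {M : Type*} [AddCommMonoid M] (f : ℤ → M) (n : ℕ) :
    ∑ i ∈ Finset.Icc (-1 : ℤ) ((n : ℤ) - 1), f i = f (-1) + ∑ i ∈ Finset.range n, f i := by
  rw [← sum_Icc_zero, ← Finset.sum_insert (by simp)]
  congr 1
  ext i
  simp only [Finset.mem_insert, Finset.mem_Icc]
  omega

/-- The expansion of the monomial with all exponents zero is `1`. -/
theorem phiExpansion_zero [CharZero K] : phiExpansion K (0 : (s : Side) → Fin (N s) → ℤ) = 1 := by
  classical
  ext q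
  have hpi (i ι : ℤ) : phiTerm K (0 : (s : Side) → Fin (N s) → ℤ) i ι =
      Phi K fun s j => nuPar (Side.pair i ι s) j := by
    simp [phiTerm, piPar]
  have e1 (i ι : ℤ) (hi : i < N .plain) (hι : ι < N .tilde) :
      coeff q (xiF N K .plain i * xiF N K .tilde ι * phiTerm K 0 i ι) =
        fCoef K (castExp q) .plain i * fCoef K (castExp q) .tilde ι := by
    have hI : ∀ s, Side.pair i ι s < N s := by rintro (_ | _) <;> simpa [Side.pair]
    have := coeff_fVec_mul K (Side.pair i ι) hI q
    rwa [← xiF_mul_xiF K _ hI, ← hpi] at this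
  have e2 (i ι : ℤ) (hi : i < N .plain) (hι : ι < N .tilde) (hi0 : 0 ≤ i) (hι0 : 0 ≤ ι) :
      coeff q (xiG N K .plain i * xiG N K .tilde ι * phiTerm K 0 i ι) =
        gCoef K (castExp q) .plain i * gCoef K (castExp q) .tilde ι := by
    have hI : ∀ s, Side.pair i ι s < N s := by rintro (_ | _) <;> simpa [Side.pair]
    have hI0 : ∀ s, 0 ≤ Side.pair i ι s := by rintro (_ | _) <;> simpa [Side.pair]
    have := coeff_gVec_mul K (Side.pair i ι) hI hI0 q
    rwa [← xiG_mul_xiG K _ hI (fun s => by have := hI s; have := hI0 s; omega), ← hpi] at this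
  rw [phiExpansion, map_sub, map_sum, map_sum]
  simp only [map_sum]
  rw [Finset.sum_congr rfl fun i hi => Finset.sum_congr rfl fun ι hι => e1 i ι
      (by have := Finset.mem_Icc.1 hi; omega) (by have := Finset.mem_Icc.1 hι; omega),
    Finset.sum_congr rfl fun i hi => Finset.sum_congr rfl fun ι hι => e2 i ι
      (by have := Finset.mem_Icc.1 hi; omega) (by have := Finset.mem_Icc.1 hι; omega)
      (Finset.mem_Icc.1 hi).1 (Finset.mem_Icc.1 hι).1,
    ← Finset.sum_mul_sum, ← Finset.sum_mul_sum, sum_Icc_neg_one, sum_Icc_neg_one, sum_Icc_zero,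
    sum_Icc_zero, coef_normalisation K (castExp q) (by simp [castExp]), coeff_one]
  -- At $q=0$ the bracket is the constant coefficient of $\Phi(0)$. For $q\ne0$ a nonzero value
  -- would require $p_{-1}=\tilde p_{-1}=0$ with nonvanishing factors, and then all exponents are
  -- zero.
  by_cases hq : q = 0
  · subst hq
    have hz (s) : prevExp (castExp (0 : XiVar N →₀ ℕ)) s 0 = 0 := by
      rw [prevExp_castExp]; simp [pPrev, mAbs, nAbs, mExp, nExp]
    have := coeff_phiSeries K (0 : Idx N → ℤ) 0
    rw [coeff_zero_eq_constantCoeff_apply, constantCoeff_phiSeries, phiCoef,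
      ← Finset.univ_sigma_univ, Finset.prod_sigma, Side.prod_univ] at this
    simp only [hz, and_self, if_true, mul_one]
    rw [fCoef_neg_one, fCoef_neg_one, ← Fin.prod_univ_eq_prod_range (fun j => negQuad K _ _ _ _),
      ← Fin.prod_univ_eq_prod_range (fun j => negQuad K _ _ _ _), this]
    simp [phiCoefAt]
  · rw [if_neg hq]
    split_ifs with h
    · rw [mul_one]
      by_contra hne
      have hs (s) : prevExp (castExp q) s 0 = 0 ∧ fCoef K (castExp q) s (-1) ≠ 0 := by
        cases s
        · exact ⟨h.1, left_ne_zero_of_mul hne⟩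
        · exact ⟨h.2, right_ne_zero_of_mul hne⟩
      refine hq (Finsupp.ext fun v => ?_)
      cases v with
      | x s i => simpa [xExp, castExp] using (exps_eq_zero K (hs s).1 (hs s).2 i.2).1
      | y s i ho => simpa [yExp, castExp, ho] using (exps_eq_zero K (hs s).1 (hs s).2 i.2).2.1
      | z s i =>
        simpa [zExp, castExp] using
          (exps_eq_zero K (hs s).1 (hs s).2 (j := i) (by omega)).2.2
    · rw [mul_zero]

end Normalisation

/-! ### The rescaled system: uniqueness, solution, monomials -/

section Rescaled

variable {N : Side → ℕ} {K : Type*} [Field K]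

theorem Phi_eq_phiSeries (μ : Side → ℕ → ℤ) :
    Phi K μ = phiSeries K fun t : Idx N => μ t.1 t.2 := by
  ext q
  rw [coeff_Phi, coeff_phiSeries]

theorem comp_zero {S : Type*} [Zero S] [One S] (u : (s : Side) → Fin (N s) → S) (s : Side) :
    comp u s 0 = 1 := if_pos rfl

theorem comp_succ {S : Type*} [Zero S] [One S] (u : (s : Side) → Fin (N s) → S) {s : Side} {n : ℕ}
    (h : n < N s) : comp u s (n + 1) = u s ⟨n, h⟩ := by
  simp [comp, h]

theorem comp_of_lt {S : Type*} [Zero S] [One S] (u : (s : Side) → Fin (N s) → S) {s : Side} {n : ℕ}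
    (h : N s < n) : comp u s n = 0 := by
  rw [comp, if_neg (by omega), dif_neg (by omega)]

theorem map_comp {S T : Type*} [CommRing S] [CommRing T] (f : S →+* T)
    (u : (s : Side) → Fin (N s) → S) (s : Side) (n : ℕ) :
    f (comp u s n) = comp (fun s i => f (u s i)) s n := by
  unfold comp
  split_ifs <;> simp

theorem comp_mul {S : Type*} [CommRing S] (u v : (s : Side) → Fin (N s) → S) (s : Side) (n : ℕ) :
    comp (fun s i => u s i * v s i) s n = comp u s n * comp v s n := by
  unfold comp
  split_ifs <;> simp

theorem monomialUnits_eq_prod {S : Type*} [CommRing S] (U : (s : Side) → Fin (N s) → Sˣ)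
    (k : (s : Side) → Fin (N s) → ℤ) : monomialUnits U k = ∏ s, ∏ i, U s i ^ k s i := by
  rw [Side.prod_univ, monomialUnits]

theorem monomialUnits_unitExp {S : Type*} [CommRing S] (U : (s : Side) → Fin (N s) → Sˣ)
    (s : Side) (i : Fin (N s)) : monomialUnits U (unitExp s i) = U s i := by
  rw [monomialUnits_eq_prod, Finset.prod_eq_single s, Finset.prod_eq_single i]
  · simp [unitExp]
  · intro j _ hj
    simp [unitExp, hj]
  · simp
  · intro t _ ht
    simp [unitExp, ht]
  · simp

theorem map_monomialUnits {S T : Type*} [CommRing S] [CommRing T] (f : S →+* T)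
    (U : (s : Side) → Fin (N s) → Sˣ) (k : (s : Side) → Fin (N s) → ℤ) :
    monomialUnits (fun s i => Units.map (f : S →* T) (U s i)) k =
      Units.map (f : S →* T) (monomialUnits U k) := by
  simp only [monomialUnits_eq_prod, map_prod, map_zpow]

/-- The solution of the rescaled system is unique: two solutions agree to every order. -/
theorem SolvesRescaled.unique {u u' : (s : Side) → Fin (N s) → MvPowerSeries (XiVar N) K}
    (hu : SolvesRescaled u) (hu' : SolvesRescaled u') (s : Side) (i : Fin (N s)) :
    u s i = u' s i := by
  suffices h : ∀ n s m, comp u s m - comp u' s m ∈ orderIdeal (XiVar N) K n by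
    have := eq_zero_of_forall_mem_orderIdeal fun n => h n s (i + 1)
    rwa [comp_succ _ i.2, comp_succ _ i.2, sub_eq_zero] at this
  intro n
  induction n with
  | zero => exact fun _ _ => mem_orderIdeal_zero _
  | succ n ih =>
    intro s m
    -- The term $u_{i-1}$ carries no variable and so gains no order; an inner induction outward from
    -- $u_0=1$ supplies it at order $n+1$.
    induction m with
    | zero => simp [comp_zero]
    | succ m ihm =>
      by_cases hm : m < N s
      · have e := hu s ⟨m, hm⟩
        have e' := hu' s ⟨m, hm⟩
        simp only at e e'
        have hx : xS N K s m * ((comp u s 1 - comp u' s 1) * comp u s (m + 1) +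
            comp u' s 1 * (comp u s (m + 1) - comp u' s (m + 1))) ∈ orderIdeal (XiVar N) K (n + 1) :=
          mul_mem_orderIdeal_succ (constantCoeff_xS _ _)
            (add_mem (Ideal.mul_mem_right _ _ (ih _ _)) (Ideal.mul_mem_left _ _ (ih _ _)))
        have hy : yS N K s m * ((comp u s.other 1 - comp u' s.other 1) * comp u s (m + 1) +
            comp u' s.other 1 * (comp u s (m + 1) - comp u' s (m + 1))) ∈
              orderIdeal (XiVar N) K (n + 1) :=
          mul_mem_orderIdeal_succ (constantCoeff_yS _ _)
            (add_mem (Ideal.mul_mem_right _ _ (ih _ _)) (Ideal.mul_mem_left _ _ (ih _ _)))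
        have hz : zS N K s m * (comp u s (m + 2) - comp u' s (m + 2)) ∈
            orderIdeal (XiVar N) K (n + 1) :=
          mul_mem_orderIdeal_succ (constantCoeff_zS _ _) (ih _ _)
        have := add_mem (sub_mem (sub_mem ihm hx) hy) hz
        convert this using 1
        linear_combination e - e'
      · rw [comp_of_lt _ (by omega), comp_of_lt _ (by omega), sub_zero]
        exact zero_mem _

/-- The indicator function of the first `n` positions of side `s`. -/
def initVec (N : Side → ℕ) (s : Side) (n : ℕ) : Idx N → ℤ :=
  fun t => if t.1 = s ∧ (t.2 : ℕ) < n then 1 else 0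

theorem initVec_zero (s : Side) : initVec N s 0 = 0 := by
  ext; simp [initVec]

theorem initVec_succ (s : Side) (n : ℕ) : initVec N s (n + 1) = initVec N s n + unitAt N s n := by
  ext t
  by_cases h : t.1 = s
  · simp only [initVec, unitAt, Pi.add_apply, h, true_and]
    split_ifs <;> omega
  · simp [initVec, unitAt, h]

variable [CharZero K]

theorem phiTerm_eq (k : (s : Side) → Fin (N s) → ℤ) (i ι : ℤ) :
    phiTerm K k i ι = towerSeries (fun t => piPar k t.1 t.2) * phiTerm K 0 i ι := by
  have h0 : phiTerm K (0 : (s : Side) → Fin (N s) → ℤ) i ι =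
      phiSeries K fun t => nuPar (Side.pair i ι t.1) t.2 := by
    rw [phiTerm, Phi_eq_phiSeries]
    simp [piPar]
  rw [h0, phiSeries_eq (fun t => nuPar (Side.pair i ι t.1) t.2), ← mul_assoc, ← towerSeries_add,
    ← phiSeries_eq, phiTerm, Phi_eq_phiSeries]
  rfl

/-- Every $\Phi$ in the expansion carries the common factor $w^\pi$, and the cofactor is $E_0=1$. -/
theorem phiExpansion_eq_towerSeries (k : (s : Side) → Fin (N s) → ℤ) :
    phiExpansion K k = towerSeries fun t => piPar k t.1 t.2 := by
  have : phiExpansion K k = towerSeries (fun t => piPar k t.1 t.2) * phiExpansion K 0 := by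
    simp only [phiExpansion, phiTerm_eq k, mul_sub, Finset.mul_sum, mul_left_comm (towerSeries _)]
  rw [this, phiExpansion_zero, mul_one]

variable (N K) in
/-- The solution of the rescaled system. -/
noncomputable def rescaledSolution (s : Side) (i : Fin (N s)) : (MvPowerSeries (XiVar N) K)ˣ :=
  (towerUnit N K (initVec N s (i + 1))).toMul

theorem comp_rescaledSolution {s : Side} {n : ℕ} (h : n ≤ N s) :
    comp (fun s i => (rescaledSolution N K s i : MvPowerSeries (XiVar N) K)) s n =
      towerSeries (initVec N s n) := by
  rcases n with _ | n
  · rw [comp_zero, initVec_zero, towerSeries_zero]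
  · rw [comp_succ _ (by omega)]
    rfl

theorem solvesRescaled_rescaledSolution :
    SolvesRescaled fun s i => (rescaledSolution N K s i : MvPowerSeries (XiVar N) K) := by
  intro s i
  -- With $u_n=w^{(1,\dots,1,0,\dots)}$ ($n$ ones), the relation at this $\mu$ is the $(i+1)$-st
  -- equation: its left side is $u_i$, and the shifted terms are products with $u_1$, $\tilde u_1$
  -- and the next component.
  have h := isTower_towerSeries (K := K) (initVec N s (i + 1)) ⟨s, i⟩
  simp only at h
  rw [← initVec_succ, towerSeries_add, towerSeries_add _ (unitAt N s.other 0)] at h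
  have h1 (s : Side) : unitAt N s 0 = initVec N s 1 := by
    rw [initVec_succ, initVec_zero, zero_add]
  rw [h1, h1, initVec_succ s i, add_sub_cancel_right, ← initVec_succ] at h
  -- Beyond the end of a side `comp` is $0$ whereas `towerSeries` of the truncated vector is a unit;
  -- the mismatch is harmless because the coefficient $y$ or $z$ vanishes there.
  have hy : yS N K s i * towerSeries (initVec N s.other 1) = yS N K s i *
      comp (fun s i => (rescaledSolution N K s i : MvPowerSeries (XiVar N) K)) s.other 1 := by
    by_cases ho : 0 < N s.other
    · rw [comp_rescaledSolution ho]
    · simp [yS, ho]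
  have hz : zS N K s i * towerSeries (initVec N s (i + 2)) = zS N K s i *
      comp (fun s i => (rescaledSolution N K s i : MvPowerSeries (XiVar N) K)) s (i + 2) := by
    by_cases ho : (i : ℕ) < N s - 1
    · rw [comp_rescaledSolution (by omega)]
    · simp [zS, ho]
  rw [comp_rescaledSolution (show (i : ℕ) + 1 ≤ N s by omega), comp_rescaledSolution i.2.le,
    comp_rescaledSolution i.pos, ← hz]
  linear_combination -h - towerSeries (initVec N s (i + 1)) * hy

theorem monomialUnits_rescaledSolution (k : (s : Side) → Fin (N s) → ℤ) :
    (monomialUnits (rescaledSolution N K) k : MvPowerSeries (XiVar N) K) = phiExpansion K k := by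
  -- As $u_{l+1}=w_0\cdots w_l$, the exponent of $w_j$ collects all $k$ with index $l\ge j$.
  have hk : (fun t : Idx N => piPar k t.1 t.2) = ∑ s, ∑ i, k s i • initVec N s (i + 1) := by
    ext ⟨s, j⟩
    rw [Finset.sum_apply, Finset.sum_eq_single s]
    · simp [piPar, initVec, Finset.sum_apply]
    · intro s' _ hs
      simp [Finset.sum_apply, initVec, hs.symm]
    · simp
  rw [phiExpansion_eq_towerSeries, hk, towerSeries, monomialUnits_eq_prod]
  simp only [map_sum, toMul_sum, map_zsmul, toMul_zsmul]
  rfl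

end Rescaled

/-! ### The eigenpair of the Jacobi matrix -/

section Eigenpair

variable {N : Side → ℕ} {K : Type*} [Field K]

theorem eq_center_or_eq_node (j : Fin (dim N)) : j = center N ∨ ∃ s i, j = node s i := by
  have hj : (j : ℕ) < N .tilde + 1 + N .plain := j.2
  rcases lt_trichotomy (j : ℕ) (N .tilde) with h | h | h
  · exact .inr ⟨.tilde, ⟨N .tilde - 1 - j, by omega⟩, Fin.ext (by simp only [node]; omega)⟩
  · exact .inl (Fin.ext h)
  · exact .inr ⟨.plain, ⟨j - N .tilde - 1, by omega⟩, Fin.ext (by simp only [node]; omega)⟩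

theorem node_ne_center (s : Side) (i : Fin (N s)) : node s i ≠ center N := by
  cases s <;> simp [node, center, Fin.ext_iff]
  omega

/-- The vector with entry `1` at the centre and the given entries on the two sides. -/
def assemble {R : Type*} [One R] (v : (s : Side) → Fin (N s) → R) (j : Fin (dim N)) : R :=
  if h : (j : ℕ) < N .tilde then v .tilde ⟨N .tilde - 1 - j, by omega⟩
  else if h' : (j : ℕ) = N .tilde then 1
  else v .plain ⟨j - N .tilde - 1, by have : (j : ℕ) < N .tilde + 1 + N .plain := j.2; omega⟩

theorem assemble_center {R : Type*} [One R] (v : (s : Side) → Fin (N s) → R) :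
    assemble v (center N) = 1 := by
  simp [assemble, center]

theorem assemble_node {R : Type*} [One R] (v : (s : Side) → Fin (N s) → R) (s : Side)
    (i : Fin (N s)) : assemble v (node s i) = v s i := by
  cases s with
  | plain =>
    rw [assemble, dif_neg (by simp only [node]; omega), dif_neg (by simp only [node]; omega)]
    congr 1
    ext
    simp only [node]
    omega
  | tilde =>
    rw [assemble, dif_pos (by simp only [node]; omega)]
    congr 1
    ext
    simp only [node]
    omega

theorem jacobiMatrix_mulVec (α : Fin (dim N) → K) (V : Fin (dim N) → MvPowerSeries (OffVar N) K)
    (i : Fin (dim N)) : (jacobiMatrix α).mulVec V i = C (α i) * V i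
      + (if h : (i : ℕ) + 1 < dim N then
          X (.beta ⟨i, by unfold dim at h; omega⟩) * V ⟨i + 1, h⟩ else 0)
      + (if h : 0 < (i : ℕ) then
          X (.gamma ⟨i - 1, by have := i.isLt; unfold dim at this; omega⟩) *
            V ⟨i - 1, by omega⟩ else 0) := by
  have hsplit (j : Fin (dim N)) : jacobiMatrix α i j * V j = (if i = j then C (α i) * V j else 0)
      + (if h : (i : ℕ) + 1 = j then
          X (.beta ⟨i, by have := j.isLt; unfold dim at this; omega⟩) * V j else 0)
      + (if h : (j : ℕ) + 1 = i then
          X (.gamma ⟨j, by have := i.isLt; unfold dim at this; omega⟩) * V j else 0) := by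
    unfold jacobiMatrix
    by_cases h1 : i = j
    · subst h1; simp
    by_cases h2 : (i : ℕ) + 1 = j
    · have h3 : ¬ (j : ℕ) + 1 = i := by omega
      simp [h1, h2, h3]
    · simp only [h1, h2, if_false, dif_neg, not_false_eq_true, zero_add]
      split_ifs <;> simp
  simp only [Matrix.mulVec, dotProduct, hsplit, Finset.sum_add_distrib]
  congr 1
  · congr 1
    · simp
    · split_ifs with h
      · rw [Finset.sum_eq_single ⟨i + 1, h⟩]
        · simp
        · intro j _ hj
          exact dif_neg fun e => hj (Fin.ext e.symm)
        · simp
      · exact Finset.sum_eq_zero fun j _ => dif_neg fun e => h (by omega)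
  · split_ifs with h
    · rw [Finset.sum_eq_single ⟨i - 1, by omega⟩]
      · simp [Nat.sub_add_cancel (show 1 ≤ (i : ℕ) from h)]
      · intro j _ hj
        exact dif_neg fun e => hj (Fin.ext (by simp only; omega))
      · simp
    · exact Finset.sum_eq_zero fun j _ => dif_neg fun e => h (by omega)

/-- `outward`, extended by `0` beyond the end of the side. -/
noncomputable def outwardExt (K : Type*) [Field K] (s : Side) (n : ℕ) :
    MvPowerSeries (OffVar N) K :=
  if h : n < N s then outward K s ⟨n, h⟩ else 0

theorem jacobiMatrix_mulVec_center (α : Fin (dim N) → K)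
    (V : Fin (dim N) → MvPowerSeries (OffVar N) K) :
    (jacobiMatrix α).mulVec V (center N) = C (α (center N)) * V (center N)
      + (couplingTerm (fun s i => V (node s i)) .tilde
        + couplingTerm (fun s i => V (node s i)) .plain) := by
  rw [jacobiMatrix_mulVec, add_assoc, add_comm (couplingTerm _ _)]
  congr 2
  · unfold couplingTerm
    by_cases h : 0 < N .plain
    · rw [dif_pos h, dif_pos (by simp only [center]; unfold dim; omega)]
      rfl
    · rw [dif_neg h, dif_neg (by simp only [center]; unfold dim; omega)]

theorem jacobiMatrix_mulVec_node (α : Fin (dim N) → K)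
    (V : Fin (dim N) → MvPowerSeries (OffVar N) K) (hV : V (center N) = 1) (s : Side)
    (i : Fin (N s)) :
    (jacobiMatrix α).mulVec V (node s i) = C (α (node s i)) * V (node s i)
      + inward K s i * comp (fun s i => V (node s i)) s i
      + outwardExt K s (i + 1) * comp (fun s i => V (node s i)) s (i + 2) := by
  have hi := i.2
  -- The neighbour towards the centre; for $i=0$ it is the centre itself, where $V_k=1$ matches
  -- `comp_zero`.
  have hin (j : Fin (dim N)) (hj : (j : ℕ) = match s with
      | .plain => N .tilde + i
      | .tilde => N .tilde - i) : V j = comp (fun s i => V (node s i)) s i := by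
    obtain ⟨i, hi⟩ := i
    rcases i with _ | i
    · rw [comp_zero, ← hV]
      congr 1
      ext
      cases s <;> simpa [center] using hj
    · rw [comp_succ _ (by omega)]
      congr 1
      ext
      cases s <;> simpa [node] using hj
  rw [jacobiMatrix_mulVec]
  cases s with
  | plain =>
    rw [add_assoc, add_assoc, add_comm (inward K _ _ * _)]
    congr 2
    · by_cases h : (i : ℕ) + 1 < N .plain
      · rw [dif_pos (by simp only [node]; unfold dim; omega), outwardExt, dif_pos h, comp_succ _ h]
        rfl
      · rw [dif_neg (by simp only [node]; unfold dim; omega), outwardExt, dif_neg h, zero_mul]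
    · rw [dif_pos (by simp only [node]; omega)]
      congr 1
      exact hin _ rfl
  | tilde =>
    rw [add_assoc, add_assoc]
    congr 2
    · rw [dif_pos (by simp only [node]; unfold dim; omega)]
      congr 1
      · simp only [inward, node]
        congr 3
        omega
      · exact hin _ (by simp only [node]; omega)
    · by_cases h : (i : ℕ) + 1 < N .tilde
      · rw [dif_pos (by simp only [node]; omega), outwardExt, dif_pos h, comp_succ _ h]
        simp only [outward, node, Nat.sub_sub, add_comm 1]
      · rw [dif_neg (by simp only [node]; omega), outwardExt, dif_neg h, zero_mul]

theorem constantCoeff_outward (s : Side) (i : Fin (N s)) :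
    constantCoeff (outward K s i) = 0 := by
  cases s <;> simp [outward]

theorem constantCoeff_inward (s : Side) (i : Fin (N s)) :
    constantCoeff (inward K s i) = 0 := by
  cases s <;> simp [inward]

theorem constantCoeff_outwardExt (s : Side) (n : ℕ) :
    constantCoeff (outwardExt K s n : MvPowerSeries (OffVar N) K) = 0 := by
  unfold outwardExt; split <;> simp [constantCoeff_outward]

theorem constantCoeff_couplingTerm (v : (s : Side) → Fin (N s) → MvPowerSeries (OffVar N) K)
    (s : Side) : constantCoeff (couplingTerm v s) = 0 := by
  unfold couplingTerm; split <;> simp [constantCoeff_outward]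

/-- The correction `λ` to the eigenvalue. -/
noncomputable def eigenShift (v : (s : Side) → Fin (N s) → MvPowerSeries (OffVar N) K) :
    MvPowerSeries (OffVar N) K :=
  couplingTerm v .tilde + couplingTerm v .plain

/-- The eigenvalue equation, written for the components off the centre. -/
theorem isEigenBranch_iff (α : Fin (dim N) → K) (L : MvPowerSeries (OffVar N) K)
    (V : Fin (dim N) → MvPowerSeries (OffVar N) K) :
    IsEigenBranch α L V ↔ V (center N) = 1 ∧
      L = C (α (center N)) + eigenShift (fun s i => V (node s i)) ∧
      ∀ s i, constantCoeff (V (node s i)) = 0 ∧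
        C (diagDiff α s i) * V (node s i) + inward K s i * comp (fun s i => V (node s i)) s i
          + outwardExt K s (i + 1) * comp (fun s i => V (node s i)) s (i + 2) =
        eigenShift (fun s i => V (node s i)) * V (node s i) := by
  constructor
  · rintro ⟨hMV, hc, -, h0⟩
    -- Since $V_k=1$, the centre row reads off the eigenvalue, which is then eliminated from the
    -- other rows.
    have hL := congrFun hMV (center N)
    rw [jacobiMatrix_mulVec_center, hc, Pi.smul_apply, hc, smul_eq_mul, mul_one, mul_one] at hL
    refine ⟨hc, hL.symm, fun s i => ⟨h0 _ (node_ne_center s i), ?_⟩⟩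
    have h := congrFun hMV (node s i)
    rw [jacobiMatrix_mulVec_node _ _ hc, Pi.smul_apply, smul_eq_mul, ← hL] at h
    rw [diagDiff, map_sub, eigenShift]
    linear_combination h
  · rintro ⟨hc, hL, h⟩
    refine ⟨funext fun j => ?_, hc, ?_, fun j hj => ?_⟩
    · rw [Pi.smul_apply, smul_eq_mul]
      rcases eq_center_or_eq_node j with rfl | ⟨s, i, rfl⟩
      · rw [jacobiMatrix_mulVec_center, hc, hL, mul_one, mul_one, eigenShift]
      · have := (h s i).2
        rw [diagDiff, map_sub] at this
        rw [jacobiMatrix_mulVec_node _ _ hc, hL]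
        linear_combination this
    · simp [hL, eigenShift, constantCoeff_couplingTerm]
    · rcases eq_center_or_eq_node j with rfl | ⟨s, i, rfl⟩
      · exact absurd rfl hj
      · exact (h s i).1

theorem diagDiff_ne_zero {α : Fin (dim N) → K} (hα : ∀ j, j ≠ center N → α j ≠ α (center N))
    (s : Side) (i : Fin (N s)) : diagDiff α s i ≠ 0 :=
  sub_ne_zero.2 (hα _ (node_ne_center s i))

theorem IsEigenBranch.unique {α : Fin (dim N) → K} (hα : ∀ j, j ≠ center N → α j ≠ α (center N))
    {L L' : MvPowerSeries (OffVar N) K} {V V' : Fin (dim N) → MvPowerSeries (OffVar N) K}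
    (h : IsEigenBranch α L V) (h' : IsEigenBranch α L' V') : L = L' ∧ V = V' := by
  rw [isEigenBranch_iff] at h h'
  obtain ⟨hc, hL, h⟩ := h
  obtain ⟨hc', hL', h'⟩ := h'
  -- Subtracting the two equations gives $a(V-V')=(\lambda-\lambda')V+\lambda'(V-V')$ minus
  -- off-diagonal multiples of neighbouring differences. Every term on the right gains one order,
  -- and $a$ is an invertible constant.
  have key : ∀ n s i, V (node s i) - V' (node s i) ∈ orderIdeal (OffVar N) K n := by
    intro n
    induction n with
    | zero => exact fun _ _ => mem_orderIdeal_zero _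
    | succ n ih =>
      have hcomp (s m) : comp (fun s i => V (node s i)) s m - comp (fun s i => V' (node s i)) s m ∈
          orderIdeal (OffVar N) K n := by
        unfold comp
        split_ifs
        · simp
        · exact ih _ _
        · simp
      have hcoup (s) : couplingTerm (fun s i => V (node s i)) s -
          couplingTerm (fun s i => V' (node s i)) s ∈ orderIdeal (OffVar N) K (n + 1) := by
        unfold couplingTerm
        split_ifs
        · rw [← mul_sub]
          exact mul_mem_orderIdeal_succ (constantCoeff_outward _ _) (ih _ _)
        · simp
      have hshift : eigenShift (fun s i => V (node s i)) - eigenShift (fun s i => V' (node s i)) ∈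
          orderIdeal (OffVar N) K (n + 1) := by
        rw [eigenShift, eigenShift, add_sub_add_comm]
        exact add_mem (hcoup _) (hcoup _)
      intro s i
      have hC : C (diagDiff α s i)⁻¹ * C (diagDiff α s i) = (1 : MvPowerSeries (OffVar N) K) := by
        rw [← map_mul, inv_mul_cancel₀ (diagDiff_ne_zero hα s i), map_one]
      have hm1 := Ideal.mul_mem_right (V (node s i)) _ hshift
      have hm2 := mul_mem_orderIdeal_succ (f := eigenShift fun s i => V' (node s i))
        (by simp [eigenShift, constantCoeff_couplingTerm]) (ih s i)
      have hm3 := mul_mem_orderIdeal_succ (constantCoeff_inward (K := K) s i) (hcomp s i)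
      have hm4 := mul_mem_orderIdeal_succ (constantCoeff_outwardExt (K := K) s (i + 1))
        (hcomp s (i + 2))
      have := Ideal.mul_mem_left _ (C (diagDiff α s i)⁻¹) (sub_mem (sub_mem (add_mem hm1 hm2) hm3) hm4)
      convert this using 1
      linear_combination C (diagDiff α s i)⁻¹ * ((h s i).2 - (h' s i).2) -
        (V (node s i) - V' (node s i)) * hC
  have hV : V = V' := by
    ext1 j
    rcases eq_center_or_eq_node j with rfl | ⟨s, i, rfl⟩
    · rw [hc, hc']
    · exact sub_eq_zero.1 (eq_zero_of_forall_mem_orderIdeal fun n => key n s i)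
  exact ⟨by rw [hL, hL', hV], hV⟩

/-- The scale is the leading-order solution: it balances $a_{i+1}v_{i+1}+c_iv_i=0$, the row without
$\lambda$ and the outward coupling. -/
theorem comp_scaleFactor_succ (α : Fin (dim N) → K) (s : Side) (i : Fin (N s)) :
    comp (scaleFactor α) s (i + 1) =
      -(C (diagDiff α s i)⁻¹ * inward K s i * comp (scaleFactor α) s i) := by
  obtain ⟨i, hi⟩ := i
  rcases i with _ | i
  · rw [comp_succ _ hi, comp_zero, scaleFactor]
    have : Finset.Iic (⟨0, hi⟩ : Fin (N s)) = {⟨0, hi⟩} := by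
      ext j; simp [Fin.le_def, Fin.ext_iff]
    simp [this, neg_div]
  · rw [comp_succ _ hi, comp_succ _ (by omega), scaleFactor, scaleFactor]
    have : Finset.Iic (⟨i + 1, hi⟩ : Fin (N s)) = insert ⟨i + 1, hi⟩ (Finset.Iic ⟨i, by omega⟩) := by
      ext j; simp [Fin.le_def, Fin.ext_iff]; omega
    rw [this, Finset.prod_insert (by simp [Fin.le_def]), Finset.prod_insert (by simp [Fin.le_def]),
      pow_succ, div_eq_mul_inv, mul_inv]
    simp only [map_mul, map_neg, map_one, div_eq_mul_inv]
    ring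

theorem constantCoeff_scaleFactor (α : Fin (dim N) → K) (s : Side) (i : Fin (N s)) :
    constantCoeff (scaleFactor α s i) = 0 := by
  have := comp_scaleFactor_succ α s i
  rw [comp_succ _ i.2] at this
  simp [this, constantCoeff_inward]

/-- The substitution of the values of `ξ`. -/
noncomputable def substHom (α : Fin (dim N) → K) :
    MvPowerSeries (XiVar N) K →+* MvPowerSeries (OffVar N) K :=
  (substAlgHom (hasSubst_xiVal α) : MvPowerSeries (XiVar N) K →ₐ[K] MvPowerSeries (OffVar N) K)

theorem substHom_apply (α : Fin (dim N) → K) (f : MvPowerSeries (XiVar N) K) :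
    substHom α f = subst (xiVal α) f :=
  congrFun (coe_substAlgHom (hasSubst_xiVal α)) f

theorem substHom_X (α : Fin (dim N) → K) (v : XiVar N) : substHom α (X v) = xiVal α v := by
  rw [substHom_apply, subst_X (hasSubst_xiVal α)]

/-- A solution of the rescaled system gives an eigenvector. -/
theorem isEigenBranch_of_solvesRescaled {α : Fin (dim N) → K}
    (hα : ∀ j, j ≠ center N → α j ≠ α (center N))
    {u : (s : Side) → Fin (N s) → MvPowerSeries (XiVar N) K} (hu : SolvesRescaled u)
    {V : Fin (dim N) → MvPowerSeries (OffVar N) K} (hc : V (center N) = 1)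
    (hV : ∀ s i, V (node s i) = scaleFactor α s i * substHom α (u s i)) :
    IsEigenBranch α (C (α (center N)) + eigenShift fun s i => V (node s i)) V := by
  rw [isEigenBranch_iff]
  refine ⟨hc, rfl, fun s i => ⟨by simp [hV, constantCoeff_scaleFactor], ?_⟩⟩
  set S := comp (scaleFactor α) with hS
  set w := comp fun s i => substHom α (u s i) with hw
  have hcomp (s n) : comp (fun s i => V (node s i)) s n = S s n * w s n := by
    simp only [hV]
    rw [comp_mul]
  have hsys := congrArg (substHom α) (hu s i)
  simp only [map_add, map_sub, map_mul, map_comp, ← hw] at hsys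
  have hS1 := comp_scaleFactor_succ α s i
  rw [← hS] at hS1
  have hcoup (s' : Side) (h : 0 < N s') : couplingTerm (fun s i => V (node s i)) s' =
      -(C (diagDiff α s' ⟨0, h⟩)⁻¹ * outward K s' ⟨0, h⟩ * inward K s' ⟨0, h⟩ * w s' 1) := by
    have := comp_scaleFactor_succ α s' ⟨0, h⟩
    have hv := hcomp s' 1
    rw [comp_succ _ h] at hv
    simp only [zero_add, comp_zero, ← hS] at this
    rw [couplingTerm, dif_pos h, hv, this]
    ring
  -- This and the next identities exhibit the common factor $c_i$ times the scale at distance $i$ in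
  -- each term of the row; the cofactors are exactly the substituted $x$, $y$, $z$.
  have hx : couplingTerm (fun s i => V (node s i)) s * S s (i + 1) =
      inward K s i * S s i * (substHom α (xS N K s i) * w s 1) := by
    rw [hcoup s i.pos, xS, dif_pos i.2, substHom_X, xiVal, hS1, one_div, mul_inv, map_mul]
    ring
  have hy : couplingTerm (fun s i => V (node s i)) s.other * S s (i + 1) =
      inward K s i * S s i * (substHom α (yS N K s i) * w s.other 1) := by
    by_cases h : 0 < N s.other
    · rw [hcoup _ h, yS, dif_pos ⟨i.2, h⟩, substHom_X, xiVal, hS1, one_div, mul_inv, map_mul]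
      ring
    · rw [couplingTerm, dif_neg h, yS, dif_neg (by tauto)]
      simp
  have hz : outwardExt K s (i + 1) * S s (i + 2) =
      inward K s i * S s i * substHom α (zS N K s i) := by
    by_cases h : (i : ℕ) + 1 < N s
    · have hS2 := comp_scaleFactor_succ α s ⟨i + 1, h⟩
      simp only [← hS] at hS2
      rw [outwardExt, dif_pos h, zS, dif_pos (by omega), substHom_X, xiVal, hS2, hS1, one_div,
        mul_inv, map_mul]
      ring
    · rw [outwardExt, dif_neg h, zS, dif_neg (by omega)]
      simp
  have ha : C (diagDiff α s i) * S s (i + 1) = -(inward K s i * S s i) := by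
    have hC : C (diagDiff α s i) * C (diagDiff α s i)⁻¹ = (1 : MvPowerSeries (OffVar N) K) := by
      rw [← map_mul, mul_inv_cancel₀ (diagDiff_ne_zero hα s i), map_one]
    rw [hS1]
    linear_combination -(inward K s i * S s i) * hC
  have hshift : eigenShift (fun s i => V (node s i)) =
      couplingTerm (fun s i => V (node s i)) s + couplingTerm (fun s i => V (node s i)) s.other := by
    cases s
    · exact add_comm _ _
    · rfl
  have hv := hcomp s (i + 1)
  rw [comp_succ _ i.2] at hv
  rw [hv, hcomp, hcomp, hshift]
  -- The row is the substituted rescaled equation times the common factor, so nothing has to be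
  -- divided by the scale, which is not a unit.
  linear_combination w s (i + 1) * ha + w s (i + 2) * hz - w s (i + 1) * hx - w s (i + 1) * hy -
    inward K s i * S s i * hsys

end Eigenpair

end JacobiSpectral

/-! ### Assembly of both parts -/

open JacobiSpectral
theorem proposition6 {K : Type*} [Field K] [CharZero K] (N : Side → ℕ) :
    (∃ U : (s : Side) → Fin (N s) → (MvPowerSeries (XiVar N) K)ˣ,
      SolvesRescaled (fun s i => (U s i : MvPowerSeries (XiVar N) K)) ∧
      (∀ u : (s : Side) → Fin (N s) → MvPowerSeries (XiVar N) K,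
        SolvesRescaled u → ∀ s i, u s i = U s i) ∧
      ∀ k : (s : Side) → Fin (N s) → ℤ,
        (monomialUnits U k : MvPowerSeries (XiVar N) K) = phiExpansion K k) ∧
    (∀ α : Fin (dim N) → K, (∀ j, j ≠ center N → α j ≠ α (center N)) →
      ∃ (Λ : MvPowerSeries (OffVar N) K) (V : Fin (dim N) → MvPowerSeries (OffVar N) K)
        (U : (s : Side) → Fin (N s) → (MvPowerSeries (OffVar N) K)ˣ),
        IsEigenBranch α Λ V ∧
        (∀ Λ' V', IsEigenBranch α Λ' V' → Λ' = Λ ∧ V' = V) ∧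
        (∀ s i, V (node s i) = scaleFactor α s i * (U s i : MvPowerSeries (OffVar N) K)) ∧
        (∀ k : (s : Side) → Fin (N s) → ℤ,
          (monomialUnits U k : MvPowerSeries (OffVar N) K) =
            MvPowerSeries.subst (xiVal α) (phiExpansion K k)) ∧
        (∀ s i, V (node s i) = componentSeries α s i) ∧
        Λ = MvPowerSeries.C (α (center N)) +
          (couplingTerm (fun s i => V (node s i)) .tilde +
            couplingTerm (fun s i => V (node s i)) .plain) ∧
        Λ = MvPowerSeries.C (α (center N)) +
          (couplingTerm (componentSeries α) .tilde +
            couplingTerm (componentSeries α) .plain)) := by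
  refine ⟨⟨rescaledSolution N K, solvesRescaled_rescaledSolution,
    fun u hu => hu.unique solvesRescaled_rescaledSolution, monomialUnits_rescaledSolution⟩, ?_⟩
  intro α hα
  -- Substitution is a ring homomorphism, so it carries the unit solution and its monomial
  -- expansions over to the matrix entries.
  let U (s : Side) (i : Fin (N s)) : (MvPowerSeries (OffVar N) K)ˣ :=
    Units.map (substHom α : _ →* MvPowerSeries (OffVar N) K) (rescaledSolution N K s i)
  let V := assemble fun s i => scaleFactor α s i * (U s i : MvPowerSeries (OffVar N) K)
  have hV (s) (i : Fin (N s)) :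
      V (node s i) = scaleFactor α s i * (U s i : MvPowerSeries (OffVar N) K) :=
    assemble_node _ s i
  have hbranch := isEigenBranch_of_solvesRescaled hα solvesRescaled_rescaledSolution
    (assemble_center _ : V (center N) = 1) hV
  have hmon (k : (s : Side) → Fin (N s) → ℤ) : (monomialUnits U k : MvPowerSeries (OffVar N) K) =
      MvPowerSeries.subst (xiVal α) (phiExpansion K k) := by
    rw [← substHom_apply, ← monomialUnits_rescaledSolution, map_monomialUnits]
    rfl
  have hcomp : (fun s i => V (node s i)) = componentSeries α := by
    funext s i
    rw [hV, componentSeries, ← hmon, monomialUnits_unitExp]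
  exact ⟨_, V, U, hbranch, fun L' V' h' => h'.unique hα hbranch, hV, hmon,
    fun s i => congrFun (congrFun hcomp s) i, rfl, by rw [← hcomp]; rfl⟩
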